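/- \textbf{Setting.} Let $\mathcal S,\mathcal X,\mathcal Y,\widehat{\mathcal S}$ be finite nonempty alphabets, $P_S$ a probability distribution on $\mathcal S$, $P_{Y|X}$ a channel from $\mathcal X$ to $\mathcal Y$, $d:\mathcal S\times\widehat{\mathcal S}\to[0,+\infty]$ a distortion function, $\mathbf d\in[0,\infty)$, and $\kappa(s,x,y,\hat s)=\mathbb I\{d(s,\hat s)>\mathbf d\}$. All logarithms are natural. \textbf{The programs.} $\mathrm{OPT}(\mathrm{SC})$ is the infimum of $\sum\kappa\,Q$ over $Q=P_S\,Q_{X|S}\,P_{Y|X}\,Q_{\widehat S|Y}$ with $Q_{X|S},Q_{\widehat S|Y}$ conditional distributions (randomized codes). $\mathrm{OPT}(\mathrm{LP})$ is the infimum of $\sum\kappa(s,x,y,\hat s)P_S(s)P_{Y|X}(y|x)W(s,x,y,\hat s)$ over nonnegative $(Q_{X|S},Q_{\widehat S|Y},W)$ with $\sum_xQ_{X|S}(x|s)=1$, $\sum_{\hat s}Q_{\widehat S|Y}(\hat s|y)=1$, $\sum_xW(s,x,y,\hat s)=Q_{\widehat S|Y}(\hat s|y)$, $\sum_{\hat s}W(s,x,y,\hat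 s)=Q_{X|S}(x|s)$ and $Q_{X|S}(x|s)+Q_{\widehat S|Y}(\hat s|y)-W(s,x,y,\hat s)\le1$ for all $s,x,y,\hat s$. $\mathrm{OPT}(\mathrm{DP})$ is the supremum of $\sum_s\gamma^a(s)+\sum_y\gamma^b(y)-\sum\mu(s,x,y,\hat s)$ over real functions $\gamma^a(s),\gamma^b(y),\lambda^a(s,\hat s,y),\lambda^b(x,s,y)$ and $\mu(s,x,y,\hat s)\ge0$ such that, for all $s,x,y,\hat s$, \begin{align*} \gamma^a(s)-\sum_{y}\lambda^b(x,s,y)-\sum_{\hat s,y}\mu(s,x,y,\hat s)&\le0,\\ \gamma^b(y)-\sum_{s}\lambda^a(s,\hat s,y)-\sum_{x,s}\mu(s,x,y,\hat s)&\le0,\\ \lambda^a(s,\hat s,y)+\lambda^b(x,s,y)+\mu(s,x,y,\hat s)&\le\kappa(s,x,y,\hat s)P_S(s)P_{Y|X}(y|x). \end{align*} \textbf{Tilted information.} Let $R_S(D)=\inf\{I(S;\widehat S):P_{\widehat S|S},\ \mathbb E[d(S,\widehat S)]\le D\}$ ($+\infty$ if there is no such $P_{\widehat S|S}$) and $\mathbf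 d_{\min}=\inf\{D:R_S(D)<\infty\}$. Assume one of the following. (a) $\mathbf d>\mathbf d_{\min}$, the infimum in $R_S(\mathbf d)$ is attained by $P_{\widehat S^*|S}$, and $R_S$ is differentiable at $\mathbf d$. With $\lambda^*=-R_S'(\mathbf d)$ and $\widehat S^*$ distributed according to $P_{\widehat S^*}=\sum_sP_S(s)P_{\widehat S^*|S}(\cdot|s)$, put $$j_S(s,\mathbf d)=\log\frac1{\mathbb E[\exp(\lambda^*\mathbf d-\lambda^*d(s,\widehat S^*))]},$$ where the exponential is read as $0$ if $d(s,\widehat S^*)=\infty$. (b) $\mathbf d=0$ and for every $\hat s$ there is at most one $s$ with $P_S(s)>0$ and $d(s,\hat s)=0$. Put $j_S(s,0)=\log\frac1{P_S(s)}$. (Values of $j_S$ at letters with $P_S(s)=0$ are immaterial; any real value may be used.) \textbf{Auxiliary variables.} For a positive integer $T$, let $V$ take values in $\{1,\dots,T\}$ and be given by conditional distributions $P_{V|X}$, $P_{Y|X,V}$ with $P_{Y|X}(y|x)=\sum_{t=1}^TP_{Y|X,V}(y|x,t)P_{V|X}(t|x)$, and let $P_{\bar Y|V=t}$, $t=1,\dots,T$,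 be arbitrary distributions on $\mathcal Y$. Put $i_{X;\bar Y|V}(x;y|t)=\log\frac{P_{Y|X,V}(y|x,t)}{P_{\bar Y|V}(y|t)}\in[-\infty,\infty]$. For $\gamma\in\mathbb R$ let \begin{align*} p_\gamma(s,x)&=\mathbb P[j_S(s,\mathbf d)-i_{X;\bar Y|V}(x;Y|V)\ge\gamma]\quad\text{under }P_{V|X=x}P_{Y|X=x,V},\\ e_\gamma(s,x)&=\exp(j_S(s,\mathbf d)-\gamma)\sum_{y\in\mathcal Y}\sum_{t=1}^TP_{V|X}(t|x)P_{\bar Y|V}(y|t)\,\mathbb I\{j_S(s,\mathbf d)-i_{X;\bar Y|V}(x;y|t)<\gamma\},\\ K&=\sum_sP_S(s)\inf_xp_\gamma(s,x)-T\exp(-\gamma),\\ J&=\sum_sP_S(s)\inf_x\{p_\gamma(s,x)+e_\gamma(s,x)\}-T\exp(-\gamma). \end{align*} \textbf{Theorem.} (1) For all $\gamma\in\mathbb R$, $T\geq 1$, $V$, $\bar Y$, the point $\mu\equiv0$, \begin{align*} \lambda^b(x,s,y)&=P_S(s)\sum_{t=1}^T\Bigl[P_{Y|X,V}(y|x,t)P_{V|X}(t|x)\,\mathbb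 I\{P_{Y|X,V}(y|x,t)\le P_{\bar Y|V}(y|t)e^{j_S(s,\mathbf d)-\gamma}\}\\ &\qquad+P_{\bar Y|V}(y|t)e^{j_S(s,\mathbf d)-\gamma}P_{V|X}(t|x)\,\mathbb I\{P_{Y|X,V}(y|x,t)>P_{\bar Y|V}(y|t)e^{j_S(s,\mathbf d)-\gamma}\}\Bigr],\\ \lambda^a(s,\hat s,y)&=-P_S(s)e^{j_S(s,\mathbf d)-\gamma}\,\mathbb I\{d(s,\hat s)\le\mathbf d\}\sum_{t=1}^TP_{\bar Y|V}(y|t),\\ \gamma^a(s)&=\inf_x\sum_y\lambda^b(x,s,y),\qquad\gamma^b(y)=-e^{-\gamma}\sum_{t=1}^TP_{\bar Y|V}(y|t) \end{align*} is feasible for $\mathrm{DP}$ and has objective value $J$; moreover $e_\gamma\ge0$, so that $J\ge K$. (2) For every code, deterministic or randomized, $$\mathbb P[d(S,\widehat S)>\mathbf d]\ \ge\ \mathrm{OPT}(\mathrm{SC})\ \ge\ \mathrm{OPT}(\mathrm{LP})=\mathrm{OPT}(\mathrm{DP})\ \ge\ \sup_{\gamma\in\mathbb R,\,T}\ \sup_{\bar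 Y,V}J\ \ge\ \sup_{\gamma>0,\,T}\ \sup_{\bar Y,V}K,$$ the last expression being the generalized Kostina--Verd\'u converse. (3) There is a feasible point of $\mathrm{DP}$ with objective value at least $\sup_{\gamma,T}\sup_{\bar Y,V}J$; hence its value is at least the generalized Kostina--Verd\'u converse. -/

import Mathlib

open scoped ENNReal

noncomputable section

namespace JSCC

/-! Finite alphabets `S` (source), `X` (channel input), `Y` (channel output), `Sh` (destination).
A distribution on `α` is an element of `stdSimplex ℝ α`; a conditional distribution from `α` to `β`
is a map `k : α → β → ℝ` all of whose values `k a` are distributions on `β`. -/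

/-- `k a b` is the conditional probability of `b` given `a`. -/
def IsKernel {α β : Type*} [Fintype β] (k : α → β → ℝ) : Prop :=
  ∀ a, k a ∈ stdSimplex ℝ β

open Classical in
/-- The indicator of a proposition, as a real number. -/
def ind (p : Prop) : ℝ := if p then 1 else 0

/-! ### The problem SC, its linear programming relaxation LP, and the dual program DP -/

section Programs

variable {S X Y Sh : Type*}

/-- The variables `(Q, Q_{X|S}, Q_{Ŝ|Y})` of problem SC (over randomized codes). -/
structure SCPoint (S X Y Sh : Type*) where
  Q : S → X → Y → Sh → ℝ
  QXS : S → X → ℝ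
  QShY : Y → Sh → ℝ

/-- The variables `(Q_{X|S}, Q_{Ŝ|Y}, W)` of problem LP. -/
structure LPPoint (S X Y Sh : Type*) where
  QXS : S → X → ℝ
  QShY : Y → Sh → ℝ
  W : S → X → Y → Sh → ℝ

/-- The variables `(γᵃ, γᵇ, λᵃ, λᵇ, μ)` of problem DP. -/
structure DPPoint (S X Y Sh : Type*) where
  gammaA : S → ℝ
  gammaB : Y → ℝ
  lamA : S → Sh → Y → ℝ
  lamB : X → S → Y → ℝ
  mu : S → X → Y → Sh → ℝ

variable [Fintype S] [Fintype X] [Fintype Y] [Fintype Sh]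

/-- Feasibility for SC: `Q = P_S Q_{X|S} P_{Y|X} Q_{Ŝ|Y}` with `Q_{X|S}`, `Q_{Ŝ|Y}` conditional
distributions. -/
def SCPoint.Feasible (PS : S → ℝ) (PYX : X → Y → ℝ) (p : SCPoint S X Y Sh) : Prop :=
  (∀ s x y sh, p.Q s x y sh = PS s * p.QXS s x * PYX x y * p.QShY y sh) ∧
  IsKernel p.QXS ∧ IsKernel p.QShY

/-- The objective of SC: the expected loss. -/
def SCPoint.objective (κ : S → X → Y → Sh → ℝ) (p : SCPoint S X Y Sh) : ℝ :=
  ∑ s, ∑ x, ∑ y, ∑ sh, κ s x y sh * p.Q s x y sh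

/-- `OPT(SC)`. -/
def optSC (PS : S → ℝ) (PYX : X → Y → ℝ) (κ : S → X → Y → Sh → ℝ) : EReal :=
  ⨅ (p : SCPoint S X Y Sh) (_ : p.Feasible PS PYX), ((p.objective κ : ℝ) : EReal)

/-- Feasibility for LP. -/
structure LPPoint.Feasible (p : LPPoint S X Y Sh) : Prop where
  sum_QXS : ∀ s, ∑ x, p.QXS s x = 1
  sum_QShY : ∀ y, ∑ sh, p.QShY y sh = 1
  sum_W_x : ∀ s sh y, ∑ x, p.W s x y sh - p.QShY y sh = 0
  sum_W_sh : ∀ x s y, ∑ sh, p.W s x y sh - p.QXS s x = 0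
  mccormick : ∀ s x y sh, p.QXS s x + p.QShY y sh - p.W s x y sh ≤ 1
  QXS_nonneg : ∀ s x, 0 ≤ p.QXS s x
  QShY_nonneg : ∀ y sh, 0 ≤ p.QShY y sh
  W_nonneg : ∀ s x y sh, 0 ≤ p.W s x y sh

/-- The objective of LP. -/
def LPPoint.objective (PS : S → ℝ) (PYX : X → Y → ℝ) (κ : S → X → Y → Sh → ℝ)
    (p : LPPoint S X Y Sh) : ℝ :=
  ∑ s, ∑ x, ∑ y, ∑ sh, κ s x y sh * PS s * PYX x y * p.W s x y sh

/-- `OPT(LP)`. -/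
def optLP (PS : S → ℝ) (PYX : X → Y → ℝ) (κ : S → X → Y → Sh → ℝ) : EReal :=
  ⨅ (p : LPPoint S X Y Sh) (_ : p.Feasible), ((p.objective PS PYX κ : ℝ) : EReal)

/-- Feasibility for DP. -/
structure DPPoint.Feasible (PS : S → ℝ) (PYX : X → Y → ℝ) (κ : S → X → Y → Sh → ℝ)
    (p : DPPoint S X Y Sh) : Prop where
  D1 : ∀ x s, p.gammaA s - ∑ y, p.lamB x s y - ∑ sh, ∑ y, p.mu s x y sh ≤ 0
  D2 : ∀ sh y, p.gammaB y - ∑ s, p.lamA s sh y - ∑ x, ∑ s, p.mu s x y sh ≤ 0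
  D3 : ∀ s x y sh, p.lamA s sh y + p.lamB x s y + p.mu s x y sh ≤ κ s x y sh * PS s * PYX x y
  mu_nonneg : ∀ s x y sh, 0 ≤ p.mu s x y sh

/-- The objective of DP. -/
def DPPoint.objective (p : DPPoint S X Y Sh) : ℝ :=
  ∑ s, p.gammaA s + ∑ y, p.gammaB y - ∑ s, ∑ x, ∑ y, ∑ sh, p.mu s x y sh

/-- `OPT(DP)`. -/
def optDP (PS : S → ℝ) (PYX : X → Y → ℝ) (κ : S → X → Y → Sh → ℝ) : EReal :=
  ⨆ (p : DPPoint S X Y Sh) (_ : p.Feasible PS PYX κ), ((p.objective : ℝ) : EReal)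

/-- The excess-distortion loss `I{d(s,ŝ) > 𝐝}`. -/
def excessLoss (d : S → Sh → ℝ≥0∞) (dd : ℝ) : S → X → Y → Sh → ℝ :=
  fun s _ _ sh => ind (ENNReal.ofReal dd < d s sh)

/-- The excess distortion probability `P[d(S,Ŝ) > 𝐝]` of a deterministic code `(f, g)`. -/
def excessProb (PS : S → ℝ) (PYX : X → Y → ℝ) (d : S → Sh → ℝ≥0∞) (dd : ℝ)
    (f : S → X) (g : Y → Sh) : ℝ :=
  ∑ s, ∑ y, PS s * PYX (f s) y * ind (ENNReal.ofReal dd < d s (g y))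

end Programs

/-! ### Rate-distortion function and tilted information -/

section Tilted

variable {S Sh : Type*} [Fintype S] [Fintype Sh]

/-- The law of `Ŝ` when `S ∼ P_S` and `Ŝ` has conditional law `W` given `S`. -/
def outputLaw (PS : S → ℝ) (W : S → Sh → ℝ) (sh : Sh) : ℝ := ∑ s, PS s * W s sh

/-- `I(S;Ŝ)` in nats; terms of probability zero contribute zero. -/
def mutualInfo (PS : S → ℝ) (W : S → Sh → ℝ) : ℝ :=
  ∑ s, ∑ sh, PS s * W s sh * Real.log (W s sh / outputLaw PS W sh)

/-- `E[d(S,Ŝ)]`, possibly `∞`, with `0 · ∞ = 0`. -/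
def expDistortion (PS : S → ℝ) (d : S → Sh → ℝ≥0∞) (W : S → Sh → ℝ) : ℝ≥0∞ :=
  ∑ s, ∑ sh, ENNReal.ofReal (PS s * W s sh) * d s sh

/-- The conditional distributions `P_{Ŝ|S}` with `E[d(S,Ŝ)] ≤ D`. -/
def admissible (PS : S → ℝ) (d : S → Sh → ℝ≥0∞) (D : ℝ) : Set (S → Sh → ℝ) :=
  {W | IsKernel W ∧ (expDistortion PS d W : EReal) ≤ (D : EReal)}

/-- The rate-distortion function `R_S(D)`, equal to `∞` if no conditional distribution is
admissible. -/
def rateDistortion (PS : S → ℝ) (d : S → Sh → ℝ≥0∞) (D : ℝ) : EReal :=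
  ⨅ W ∈ admissible PS d D, ((mutualInfo PS W : ℝ) : EReal)

/-- `d_min = inf {D : R_S(D) < ∞}`. -/
def dMin (PS : S → ℝ) (d : S → Sh → ℝ≥0∞) : EReal :=
  sInf ((fun D : ℝ => (D : EReal)) '' {D : ℝ | rateDistortion PS d D < ⊤})

/-- `W` attains the infimum that defines `R_S(D)`. -/
def AttainsRate (PS : S → ℝ) (d : S → Sh → ℝ≥0∞) (D : ℝ) (W : S → Sh → ℝ) : Prop :=
  W ∈ admissible PS d D ∧ ((mutualInfo PS W : ℝ) : EReal) = rateDistortion PS d D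

/-- The rate-distortion function as a real function (meaningful where `R_S` is finite, in
particular near every `D > d_min`). -/
def realRate (PS : S → ℝ) (d : S → Sh → ℝ≥0∞) (D : ℝ) : ℝ := (rateDistortion PS d D).toReal

/-- `λ* = -R_S'(𝐝)`. -/
def lamStar (PS : S → ℝ) (d : S → Sh → ℝ≥0∞) (dd : ℝ) : ℝ := -deriv (realRate PS d) dd

open Classical in
/-- `exp(l 𝐝 - l δ)`, with the value `0` at `δ = ∞`. -/
def tiltWeight (l dd : ℝ) (δ : ℝ≥0∞) : ℝ :=
  if δ = ⊤ then 0 else Real.exp (l * dd - l * δ.toReal)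

open Classical in
/-- The tilted information `j_S(s, 𝐝)`; `Wstar` is the conditional distribution that attains
`R_S(𝐝)`, and is not used when `𝐝 = 0`. (At letters `s` with `P_S(s) = 0` the value is immaterial.)
-/
def tiltedInfo (PS : S → ℝ) (d : S → Sh → ℝ≥0∞) (dd : ℝ) (Wstar : S → Sh → ℝ) (s : S) : ℝ :=
  if dd = 0 then Real.log (1 / PS s)
  else Real.log
    (1 / ∑ sh, outputLaw PS Wstar sh * tiltWeight (lamStar PS d dd) dd (d s sh))

/-- The situations in which the tilted information is defined: either `𝐝 > d_min`, the infimum in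
`R_S(𝐝)` is attained by `Wstar` and `R_S` has a derivative at `𝐝`; or `𝐝 = 0` and every destination
letter reproduces at most one source letter of positive probability with zero distortion. -/
def TiltedSetting (PS : S → ℝ) (d : S → Sh → ℝ≥0∞) (dd : ℝ) (Wstar : S → Sh → ℝ) : Prop :=
  (dMin PS d < (dd : EReal) ∧ AttainsRate PS d dd Wstar ∧
    DifferentiableAt ℝ (realRate PS d) dd) ∨
  (dd = 0 ∧ ∀ sh, {s | 0 < PS s ∧ d s sh = 0}.Subsingleton)

end Tilted

/-! ### Auxiliary variables and the two converse bounds -/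

section Bounds

variable {S X Y Sh : Type*} [Fintype S] [Fintype X] [Fintype Y] [Fintype Sh]

/-- An auxiliary variable `V` with `T` values, given by `P_{V|X}` and `P_{Y|X,V}` that are compatible
with the channel, together with output distributions `P_{Ȳ|V}`. -/
structure Auxiliary (PYX : X → Y → ℝ) (T : ℕ) where
  PVX : X → Fin T → ℝ
  PYXV : X → Fin T → Y → ℝ
  Pbar : Fin T → Y → ℝ
  isKernel_PVX : IsKernel PVX
  isKernel_PYXV : ∀ x, IsKernel (PYXV x)
  isKernel_Pbar : IsKernel Pbar
  channel_eq : ∀ x y, PYX x y = ∑ t, PYXV x t y * PVX x t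

variable {PYX : X → Y → ℝ} {T : ℕ}

/-- `i_{X;Ȳ|V}(x;y|t) = log (P_{Y|X=x,V=t}(y) / P_{Ȳ|V=t}(y))`, in `[-∞, ∞]`. -/
def infoDensity (A : Auxiliary PYX T) (x : X) (y : Y) (t : Fin T) : EReal :=
  ENNReal.log (ENNReal.ofReal (A.PYXV x t y) / ENNReal.ofReal (A.Pbar t y))

/-- `P[j - i_{X;Ȳ|V}(x;Y|V) ≥ γ]` under `P_{V|X=x} P_{Y|X=x,V}`. -/
def probGe (A : Auxiliary PYX T) (j γ : ℝ) (x : X) : ℝ :=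
  ∑ y, ∑ t, A.PVX x t * A.PYXV x t y * ind ((γ : EReal) ≤ (j : EReal) - infoDensity A x y t)

/-- The additional term
`exp(j - γ) ∑_y ∑_t P_{V|X}(t|x) P_{Ȳ|V}(y|t) I{j - i_{X;Ȳ|V}(x;y|t) < γ}`. -/
def extraTerm (A : Auxiliary PYX T) (j γ : ℝ) (x : X) : ℝ :=
  Real.exp (j - γ) *
    ∑ y, ∑ t, A.PVX x t * A.Pbar t y * ind ((j : EReal) - infoDensity A x y t < (γ : EReal))

/-- The expression maximized in the generalized Kostina-Verdú converse. -/
def kvValue (PS : S → ℝ) (j : S → ℝ) (A : Auxiliary PYX T) (γ : ℝ) : ℝ :=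
  ∑ s, PS s * (⨅ x, probGe A (j s) γ x) - T * Real.exp (-γ)

/-- The expression maximized in the improved converse. -/
def improvedValue (PS : S → ℝ) (j : S → ℝ) (A : Auxiliary PYX T) (γ : ℝ) : ℝ :=
  ∑ s, PS s * (⨅ x, (probGe A (j s) γ x + extraTerm A (j s) γ x)) - T * Real.exp (-γ)

/-- The generalized Kostina-Verdú converse (supremum over `γ > 0`, positive `T`, and `V`, `Ȳ`). -/
def kvBound (PS : S → ℝ) (PYX : X → Y → ℝ) (j : S → ℝ) : EReal :=
  ⨆ (γ : ℝ) (_ : 0 < γ) (T : ℕ) (_ : 0 < T) (A : Auxiliary PYX T),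
    ((kvValue PS j A γ : ℝ) : EReal)

/-- The improved converse (supremum over all real `γ`, positive `T`, and `V`, `Ȳ`). -/
def improvedBound (PS : S → ℝ) (PYX : X → Y → ℝ) (j : S → ℝ) : EReal :=
  ⨆ (γ : ℝ) (T : ℕ) (_ : 0 < T) (A : Auxiliary PYX T),
    ((improvedValue PS j A γ : ℝ) : EReal)

/-- `λᵇ(x,s,y)` of the explicit dual point. -/
def dualLamB (PS : S → ℝ) (j : S → ℝ) (A : Auxiliary PYX T) (γ : ℝ) (x : X) (s : S) (y : Y) : ℝ :=
  PS s * ∑ t,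
    (A.PYXV x t y * A.PVX x t * ind (A.PYXV x t y ≤ A.Pbar t y * Real.exp (j s - γ)) +
      A.Pbar t y * Real.exp (j s - γ) * A.PVX x t *
        ind (A.Pbar t y * Real.exp (j s - γ) < A.PYXV x t y))

/-- The explicit point of DP built from the tilted information `j`, the variable `V` and the output
distributions `P_{Ȳ|V}`. -/
def dualPoint (PS : S → ℝ) (d : S → Sh → ℝ≥0∞) (dd : ℝ) (j : S → ℝ) (A : Auxiliary PYX T) (γ : ℝ) :
    DPPoint S X Y Sh where
  gammaA s := ⨅ x, ∑ y, dualLamB PS j A γ x s y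
  gammaB y := -Real.exp (-γ) * ∑ t, A.Pbar t y
  lamA s sh y :=
    -(PS s * Real.exp (j s - γ) * ind (d s sh ≤ ENNReal.ofReal dd) * ∑ t, A.Pbar t y)
  lamB x s y := dualLamB PS j A γ x s y
  mu _ _ _ _ := 0

end Bounds

end JSCC

end

/-! `LP` and `DP` have equal values by linear programming duality: weighting the constraints of `DP`
by a feasible point of `LP` gives one inequality, and Farkas' lemma turns a lower bound of `LP` into
a feasible point of `DP`. A code is a product point of `LP`, which gives `optLP ≤ optSC`.

The converse bounds are values of one explicit point of `DP`. Up to the factor `P_S(s)`, its `λᵇ` is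
`∑ₜ P_{V|X}(t|x) min (P_{Y|X,V}(y|x,t)) (P_Ȳ(y|t) exp (j(s) - γ))`. Bounding the minimum by its
first argument gives the channel, by its second argument gives `-λᵃ` on `{d ≤ 𝐝}`, and these two
bounds are the last constraint of `DP`. The constraint on `γᵇ` amounts to
`∑ₛ P_S(s) exp (j(s)) 𝕀{d(s, ŝ) ≤ 𝐝} ≤ 1` for every `ŝ`. In case (b) the sum has at most one nonzero
term. In case (a), the Gibbs variational principle evaluates the minimum over `W` of
`D(W ‖ Q | P_S) + λ* (E d - 𝐝)` as `-∑ₛ P_S(s) log E_Q[exp (λ* 𝐝 - λ* d(s, Ŝ))]`. Since `-λ*` is the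
slope of the convex function `R_S` at `𝐝`, the optimal output law minimises this over `Q`, and the
claim is the first-order condition for moving mass towards the letter `ŝ`. -/

open scoped ENNReal

noncomputable section

namespace JSCC

/-! ### Linear programming duality -/

section LinearProgramming

open Module PointedCone

variable {𝕜 V ι : Type*} [Field 𝕜] [LinearOrder 𝕜] [IsStrictOrderedRing 𝕜] [AddCommGroup V]
  [Module 𝕜 V]

theorem mem_hull_insert_of_sub_smul_mem_hull {s : Set (Dual 𝕜 V)} {f g : Dual 𝕜 V} {x₀ : V}
    (hf : f x₀ < 0) (hg : g x₀ ≤ 0) (hs : ∀ k ∈ s, 0 ≤ k x₀)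
    (h : g - (g x₀ / f x₀) • f ∈ hull 𝕜 ((fun k => k - (k x₀ / f x₀) • f) '' s)) :
    g ∈ hull 𝕜 (insert f s) := by
  let P : Dual 𝕜 V →ₗ[𝕜] Dual 𝕜 V :=
    LinearMap.id - (Dual.eval 𝕜 V x₀).smulRight ((f x₀)⁻¹ • f)
  have hP (k : Dual 𝕜 V) : P k = k - (k x₀ / f x₀) • f := by
    simp [P, smul_smul, div_eq_mul_inv]
  simp only [← hP] at h
  obtain ⟨k, hk, hkg⟩ : ∃ k ∈ hull 𝕜 s, P k = P g := by
    rwa [hull, ← LinearMap.coe_restrictScalars {c : 𝕜 // 0 ≤ c} P, Submodule.span_image] at h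
  have hkx₀ : 0 ≤ k x₀ := by
    have : x₀ ∈ dual .id (hull 𝕜 s : Set (Dual 𝕜 V)) := by
      rw [dual_hull]
      exact fun k hk => hs k hk
    exact this hk
  have hg_eq : g = ((g x₀ - k x₀) / f x₀) • f + k := by
    rw [hP, hP] at hkg
    linear_combination (norm := module) -hkg
  have hcoef : 0 ≤ (g x₀ - k x₀) / f x₀ := div_nonneg_of_nonpos (by linarith) hf.le
  rw [hg_eq]
  exact add_mem (PointedCone.smul_mem _ hcoef (Submodule.subset_span (Set.mem_insert _ _)))
    (Submodule.span_mono (Set.subset_insert _ _) hk)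

/- Induction on `t`: if dropping `f a` destroys the hypothesis, then it fails at some `x₀` with
`f a x₀ < 0`, and projecting along `x₀` onto the kernel of `f a` eliminates `f a`. -/
theorem mem_hull_image_of_forall_nonneg (t : Finset ι) (f : ι → Dual 𝕜 V) (g : Dual 𝕜 V)
    (h : ∀ x, (∀ i ∈ t, 0 ≤ f i x) → 0 ≤ g x) : g ∈ hull 𝕜 (f '' t) := by
  classical
  induction t using Finset.induction_on generalizing f g with
  | empty =>
    have hg : g = 0 := LinearMap.ext fun x =>
      le_antisymm (by simpa using h (-x) (by simp)) (h x (by simp))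
    exact hg ▸ zero_mem _
  | insert a t _ ih =>
    rw [Finset.coe_insert, Set.image_insert_eq]
    by_cases hg : ∀ x, (∀ i ∈ t, 0 ≤ f i x) → 0 ≤ g x
    · exact Submodule.span_mono (Set.subset_insert _ _) (ih f g hg)
    push Not at hg
    obtain ⟨x₀, hx₀, hgx₀⟩ := hg
    have hfa : f a x₀ < 0 := by
      by_contra! hfa
      exact hgx₀.not_ge (h x₀ ((Finset.forall_mem_insert _ _ _).2 ⟨hfa, hx₀⟩))
    have apply_sub_smul (k : Dual 𝕜 V) (x : V) :
        (k - (k x₀ / f a x₀) • f a) x = k (x - (f a x / f a x₀) • x₀) := by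
      simp only [LinearMap.sub_apply, LinearMap.smul_apply, map_sub, map_smul, smul_eq_mul]
      ring
    refine mem_hull_insert_of_sub_smul_mem_hull hfa hgx₀.le (Set.forall_mem_image.2 hx₀) ?_
    rw [Set.image_image]
    refine ih _ _ fun x hx => ?_
    simp only [apply_sub_smul] at hx ⊢
    refine h _ ((Finset.forall_mem_insert _ _ _).2 ⟨?_, hx⟩)
    simp [hfa.ne]

theorem exists_nonneg_sum_smul_eq_of_forall_nonneg [Fintype ι] (f : ι → Dual 𝕜 V) (g : Dual 𝕜 V)
    (h : ∀ x, (∀ i, 0 ≤ f i x) → 0 ≤ g x) :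
    ∃ u : ι → 𝕜, (∀ i, 0 ≤ u i) ∧ ∑ i, u i • f i = g := by
  have hg : g ∈ hull 𝕜 (Set.range f) := by
    simpa using mem_hull_image_of_forall_nonneg Finset.univ f g (by simpa using h)
  obtain ⟨u, hu⟩ := (Submodule.mem_span_range_iff_exists_fun _).1 hg
  exact ⟨fun i => u i, fun i => (u i).2, hu⟩

theorem exists_solution_or_certificate [Fintype ι] (f : ι → Dual 𝕜 V) (c : ι → 𝕜) :
    (∃ y, ∀ i, f i y ≤ c i) ∨
      ∃ u : ι → 𝕜, (∀ i, 0 ≤ u i) ∧ ∑ i, u i • f i = 0 ∧ ∑ i, u i * c i < 0 := by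
  let height : Dual 𝕜 (V × 𝕜) := LinearMap.snd 𝕜 V 𝕜
  let slack : Option ι → Dual 𝕜 (V × 𝕜) := fun o =>
    o.elim height fun i => c i • height - f i ∘ₗ LinearMap.fst 𝕜 V 𝕜
  by_cases h : ∀ z, (∀ o, 0 ≤ slack o z) → 0 ≤ (-height) z
  · obtain ⟨u, hu, hsum⟩ := exists_nonneg_sum_smul_eq_of_forall_nonneg slack _ h
    have hsum_apply (y : V) (τ : 𝕜) : u none * τ + ∑ i, u (some i) * (c i * τ - f i y) = -τ := by
      simpa [slack, height, Fintype.sum_option] using LinearMap.congr_fun hsum (y, τ)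
    refine .inr ⟨fun i => u (some i), fun i => hu _, LinearMap.ext fun y => ?_, ?_⟩
    · simpa using hsum_apply y 0
    · have := hsum_apply 0 1
      simp only [mul_one, map_zero, sub_zero] at this
      linarith [hu none]
  · push Not at h
    obtain ⟨⟨y, τ⟩, hslack, hτ⟩ := h
    replace hτ : 0 < τ := by simpa [height] using hτ
    refine .inl ⟨τ⁻¹ • y, fun i => ?_⟩
    have : f i y ≤ c i * τ := by simpa [slack, height] using hslack (some i)
    rw [map_smul, smul_eq_mul, inv_mul_le_iff₀ hτ]
    linarith

theorem exists_forall_le_and_le_of_forall_le [Fintype ι] (f : ι → Dual 𝕜 V) (g : Dual 𝕜 V)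
    (c : ι → 𝕜) (v : 𝕜) (hg : ∃ u : ι → 𝕜, (∀ i, 0 ≤ u i) ∧ ∑ i, u i • f i = g)
    (hv : ∀ u : ι → 𝕜, (∀ i, 0 ≤ u i) → ∑ i, u i • f i = g → v ≤ ∑ i, u i * c i) :
    ∃ y, (∀ i, f i y ≤ c i) ∧ v ≤ g y := by
  rcases exists_solution_or_certificate (fun o : Option ι => o.elim (-g) f)
    (fun o => o.elim (-v) c) with ⟨y, hy⟩ | ⟨u, hu, hzero, hneg⟩
  · exact ⟨y, fun i => hy (some i), neg_le_neg_iff.1 (hy none)⟩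
  exfalso
  simp only [Fintype.sum_option, Option.elim_none, Option.elim_some, smul_neg,
    neg_add_eq_zero, mul_neg] at hzero hneg
  obtain ⟨u₀, hu₀, hsum₀⟩ := hg
  -- Move from the feasible `u₀` far along the certificate `u`, and rescale.
  set δ := u none * v - ∑ i, u (some i) * c i with hδ
  have hδ_pos : 0 < δ := by linarith
  set K := (|∑ i, u₀ i * c i - v| + 1) / δ
  have hK_nonneg : 0 ≤ K := by positivity
  have hr : 0 < 1 + K * u none := by have := hu none; positivity
  have hv' := hv (fun i => (1 + K * u none)⁻¹ * (u₀ i + K * u (some i)))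
    (fun i => mul_nonneg (inv_nonneg.2 hr.le)
      (add_nonneg (hu₀ i) (mul_nonneg hK_nonneg (hu _))))
    (by
      simp only [mul_smul, add_smul, ← Finset.smul_sum, Finset.sum_add_distrib, hsum₀, ← hzero]
      rw [← mul_smul K, inv_smul_eq_iff₀ hr.ne', add_smul, one_smul])
  simp only [mul_assoc, add_mul, ← Finset.mul_sum, Finset.sum_add_distrib] at hv'
  rw [le_inv_mul_iff₀ hr] at hv'
  have hKδ : K * δ = |∑ i, u₀ i * c i - v| + 1 := div_mul_cancel₀ _ hδ_pos.ne'
  rw [hδ, mul_sub] at hKδ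
  linarith [le_abs_self (∑ i, u₀ i * c i - v)]

end LinearProgramming

/-! ### Duality of the programs LP and DP -/

section Duality

variable {S X Y Sh : Type*} [Fintype S] [Fintype X] [Fintype Y] [Fintype Sh]
  {PS : S → ℝ} {PYX : X → Y → ℝ} {κ : S → X → Y → Sh → ℝ}

theorem sum_comm_four (g : S → X → Y → Sh → ℝ) :
    ∑ s, ∑ x, ∑ y, ∑ sh, g s x y sh = ∑ y, ∑ sh, ∑ x, ∑ s, g s x y sh := by
  simp_rw [Finset.sum_comm (s := (Finset.univ : Finset X)) (t := (Finset.univ : Finset Y)),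
    Finset.sum_comm (s := (Finset.univ : Finset S)) (t := (Finset.univ : Finset Y)),
    Finset.sum_comm (s := (Finset.univ : Finset X)) (t := (Finset.univ : Finset Sh)),
    Finset.sum_comm (s := (Finset.univ : Finset S)) (t := (Finset.univ : Finset Sh)),
    Finset.sum_comm (s := (Finset.univ : Finset S)) (t := (Finset.univ : Finset X))]

/-- The left-hand sides of the constraints of DP at `q`, weighted by the variables of `p` and by
the multipliers `m` of `-μ ≤ 0`. The variables of `p` are the multipliers of the other three
families of constraints. -/
def LPPoint.lagrangian (p : LPPoint S X Y Sh) (m : S → X → Y → Sh → ℝ) (q : DPPoint S X Y Sh) :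
    ℝ :=
  ∑ s, ∑ x, p.QXS s x * (q.gammaA s - ∑ y, q.lamB x s y - ∑ sh, ∑ y, q.mu s x y sh) +
    ∑ y, ∑ sh, p.QShY y sh * (q.gammaB y - ∑ s, q.lamA s sh y - ∑ x, ∑ s, q.mu s x y sh) +
    ∑ s, ∑ x, ∑ y, ∑ sh, p.W s x y sh * (q.lamA s sh y + q.lamB x s y + q.mu s x y sh) -
    ∑ s, ∑ x, ∑ y, ∑ sh, m s x y sh * q.mu s x y sh

theorem LPPoint.lagrangian_eq (p : LPPoint S X Y Sh) (m : S → X → Y → Sh → ℝ)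
    (q : DPPoint S X Y Sh) :
    p.lagrangian m q =
      ∑ s, (∑ x, p.QXS s x) * q.gammaA s + ∑ y, (∑ sh, p.QShY y sh) * q.gammaB y +
      ∑ y, ∑ sh, ∑ s, (∑ x, p.W s x y sh - p.QShY y sh) * q.lamA s sh y +
      ∑ s, ∑ x, ∑ y, (∑ sh, p.W s x y sh - p.QXS s x) * q.lamB x s y -
      ∑ s, ∑ x, ∑ y, ∑ sh,
        (m s x y sh + p.QXS s x + p.QShY y sh - p.W s x y sh) * q.mu s x y sh := by
  have lamA_term : ∑ s, ∑ x, ∑ y, ∑ sh, p.W s x y sh * q.lamA s sh y =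
      ∑ y, ∑ sh, ∑ s, ∑ x, p.W s x y sh * q.lamA s sh y := by
    rw [sum_comm_four]
    simp_rw [Finset.sum_comm (s := (Finset.univ : Finset X))]
  have muA_term : ∑ s, ∑ x, ∑ sh, ∑ y, p.QXS s x * q.mu s x y sh =
      ∑ s, ∑ x, ∑ y, ∑ sh, p.QXS s x * q.mu s x y sh :=
    Fintype.sum_congr _ _ fun s => Fintype.sum_congr _ _ fun x => Finset.sum_comm
  have muB_term : ∑ y, ∑ sh, ∑ x, ∑ s, p.QShY y sh * q.mu s x y sh =
      ∑ s, ∑ x, ∑ y, ∑ sh, p.QShY y sh * q.mu s x y sh :=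
    (sum_comm_four fun s x y sh => p.QShY y sh * q.mu s x y sh).symm
  simp only [lagrangian, mul_sub, mul_add, sub_mul, add_mul, Finset.sum_add_distrib,
    Finset.sum_sub_distrib, Finset.mul_sum, Finset.sum_mul, lamA_term, muA_term, muB_term]
  ring

theorem LPPoint.Feasible.lagrangian_eq_objective {p : LPPoint S X Y Sh} (hp : p.Feasible)
    (q : DPPoint S X Y Sh) :
    p.lagrangian (fun s x y sh => 1 - (p.QXS s x + p.QShY y sh - p.W s x y sh)) q =
      q.objective := by
  rw [lagrangian_eq]
  simp only [hp.sum_QXS, hp.sum_QShY, hp.sum_W_x, hp.sum_W_sh, one_mul, zero_mul,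
    Finset.sum_const_zero, add_zero, DPPoint.objective]
  congr! 9
  ring

theorem DPPoint.Feasible.objective_le {q : DPPoint S X Y Sh} (hq : q.Feasible PS PYX κ)
    {p : LPPoint S X Y Sh} (hp : p.Feasible) : q.objective ≤ p.objective PS PYX κ := by
  have gammaA_part : ∑ s, ∑ x,
      p.QXS s x * (q.gammaA s - ∑ y, q.lamB x s y - ∑ sh, ∑ y, q.mu s x y sh) ≤ 0 :=
    Finset.sum_nonpos fun s _ => Finset.sum_nonpos fun x _ =>
      mul_nonpos_of_nonneg_of_nonpos (hp.QXS_nonneg s x) (hq.D1 x s)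
  have gammaB_part : ∑ y, ∑ sh,
      p.QShY y sh * (q.gammaB y - ∑ s, q.lamA s sh y - ∑ x, ∑ s, q.mu s x y sh) ≤ 0 :=
    Finset.sum_nonpos fun y _ => Finset.sum_nonpos fun sh _ =>
      mul_nonpos_of_nonneg_of_nonpos (hp.QShY_nonneg y sh) (hq.D2 sh y)
  have cost_part : ∑ s, ∑ x, ∑ y, ∑ sh,
      p.W s x y sh * (q.lamA s sh y + q.lamB x s y + q.mu s x y sh) ≤ p.objective PS PYX κ := by
    refine Finset.sum_le_sum fun s _ => Finset.sum_le_sum fun x _ => Finset.sum_le_sum fun y _ =>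
      Finset.sum_le_sum fun sh _ => ?_
    rw [mul_comm]
    exact mul_le_mul_of_nonneg_right (hq.D3 s x y sh) (hp.W_nonneg s x y sh)
  have mu_part : 0 ≤ ∑ s, ∑ x, ∑ y, ∑ sh,
      (1 - (p.QXS s x + p.QShY y sh - p.W s x y sh)) * q.mu s x y sh :=
    Finset.sum_nonneg fun s _ => Finset.sum_nonneg fun x _ => Finset.sum_nonneg fun y _ =>
      Finset.sum_nonneg fun sh _ =>
        mul_nonneg (sub_nonneg.2 (hp.mccormick s x y sh)) (hq.mu_nonneg s x y sh)
  rw [← hp.lagrangian_eq_objective q, LPPoint.lagrangian]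
  linarith

theorem optDP_le_optLP : optDP (Sh := Sh) PS PYX κ ≤ optLP PS PYX κ :=
  iSup₂_le fun _ hq => le_iInf₂ fun _ hp => EReal.coe_le_coe_iff.2 (hq.objective_le hp)

theorem LPPoint.feasible_of_lagrangian_eq_objective {p : LPPoint S X Y Sh}
    {m : S → X → Y → Sh → ℝ} (h : ∀ q, p.lagrangian m q = q.objective)
    (hQXS : ∀ s x, 0 ≤ p.QXS s x) (hQShY : ∀ y sh, 0 ≤ p.QShY y sh)
    (hW : ∀ s x y sh, 0 ≤ p.W s x y sh) (hm : ∀ s x y sh, 0 ≤ m s x y sh) : p.Feasible := by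
  classical
  simp only [lagrangian_eq, DPPoint.objective] at h
  refine ⟨fun s => ?_, fun y => ?_, fun s sh y => ?_, fun x s y => ?_, fun s x y sh => ?_,
    hQXS, hQShY, hW⟩
  · simpa [Pi.single_apply] using h ⟨Pi.single s 1, 0, 0, 0, 0⟩
  · simpa [Pi.single_apply] using h ⟨0, Pi.single y 1, 0, 0, 0⟩
  · simpa [Pi.single_apply, ite_apply, Finset.sum_ite_irrel] using
      h ⟨0, 0, Pi.single s (Pi.single sh (Pi.single y 1)), 0, 0⟩
  · simpa [Pi.single_apply, ite_apply, Finset.sum_ite_irrel] using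
      h ⟨0, 0, 0, Pi.single x (Pi.single s (Pi.single y 1)), 0⟩
  · have slack_eq : p.W s x y sh - (m s x y sh + p.QXS s x + p.QShY y sh) = -1 := by
      simpa [Pi.single_apply, ite_apply, Finset.sum_ite_irrel] using
        h ⟨0, 0, 0, 0, Pi.single s (Pi.single x (Pi.single y (Pi.single sh 1)))⟩
    linarith [hm s x y sh]

/-- The variables of DP, as the index type of the vector space in which Farkas' lemma is applied. -/
inductive DPVar (S X Y Sh : Type*)
  | gammaA (s : S)
  | gammaB (y : Y)
  | lamA (s : S) (sh : Sh) (y : Y)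
  | lamB (x : X) (s : S) (y : Y)
  | mu (s : S) (x : X) (y : Y) (sh : Sh)

/-- The constraints of DP: `D1`, `D2`, `D3` and the nonnegativity of `μ`. -/
abbrev DPConstraint (S X Y Sh : Type*) :=
  (S × X) ⊕ (Y × Sh) ⊕ (S × X × Y × Sh) ⊕ (S × X × Y × Sh)

namespace DPVar

/-- The point of DP with the given values of the variables. -/
def toDPPoint (z : DPVar S X Y Sh → ℝ) : DPPoint S X Y Sh where
  gammaA s := z (gammaA s)
  gammaB y := z (gammaB y)
  lamA s sh y := z (lamA s sh y)
  lamB x s y := z (lamB x s y)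
  mu s x y sh := z (mu s x y sh)

theorem toDPPoint_surjective {S X Y Sh : Type*} :
    Function.Surjective (toDPPoint : (DPVar S X Y Sh → ℝ) → DPPoint S X Y Sh) := fun q =>
  ⟨fun
    | gammaA s => q.gammaA s
    | gammaB y => q.gammaB y
    | lamA s sh y => q.lamA s sh y
    | lamB x s y => q.lamB x s y
    | mu s x y sh => q.mu s x y sh, rfl⟩

/-- The left-hand sides of the constraints of DP, as linear functionals. -/
def lhs : DPConstraint S X Y Sh → Module.Dual ℝ (DPVar S X Y Sh → ℝ)
  | .inl (s, x) => .proj (gammaA s) - ∑ y, .proj (lamB x s y) - ∑ sh, ∑ y, .proj (mu s x y sh)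
  | .inr (.inl (y, sh)) =>
    .proj (gammaB y) - ∑ s, .proj (lamA s sh y) - ∑ x, ∑ s, .proj (mu s x y sh)
  | .inr (.inr (.inl (s, x, y, sh))) =>
    .proj (lamA s sh y) + .proj (lamB x s y) + .proj (mu s x y sh)
  | .inr (.inr (.inr (s, x, y, sh))) => -.proj (mu s x y sh)

/-- The right-hand sides of the constraints of DP. -/
def rhs (PS : S → ℝ) (PYX : X → Y → ℝ) (κ : S → X → Y → Sh → ℝ) : DPConstraint S X Y Sh → ℝ
  | .inr (.inr (.inl (s, x, y, sh))) => κ s x y sh * PS s * PYX x y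
  | _ => 0

/-- The objective of DP, as a linear functional. -/
def objective : Module.Dual ℝ (DPVar S X Y Sh → ℝ) :=
  ∑ s, .proj (gammaA s) + ∑ y, .proj (gammaB y) - ∑ s, ∑ x, ∑ y, ∑ sh, .proj (mu s x y sh)

theorem objective_apply (z : DPVar S X Y Sh → ℝ) : objective z = (toDPPoint z).objective := by
  simp [objective, DPPoint.objective, toDPPoint]

theorem feasible_toDPPoint {z : DPVar S X Y Sh → ℝ} (h : ∀ i, lhs i z ≤ rhs PS PYX κ i) :
    (toDPPoint z).Feasible PS PYX κ where
  D1 x s := by simpa [lhs, rhs, toDPPoint] using h (.inl (s, x))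
  D2 sh y := by simpa [lhs, rhs, toDPPoint] using h (.inr (.inl (y, sh)))
  D3 s x y sh := by simpa [lhs, rhs, toDPPoint] using h (.inr (.inr (.inl (s, x, y, sh))))
  mu_nonneg s x y sh := by simpa [lhs, rhs, toDPPoint] using h (.inr (.inr (.inr (s, x, y, sh))))

/-- The point of LP whose variables are the given multipliers of the constraints of DP. -/
def toLPPoint (u : DPConstraint S X Y Sh → ℝ) : LPPoint S X Y Sh where
  QXS s x := u (.inl (s, x))
  QShY y sh := u (.inr (.inl (y, sh)))
  W s x y sh := u (.inr (.inr (.inl (s, x, y, sh))))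

theorem sum_smul_lhs_apply (u : DPConstraint S X Y Sh → ℝ) (z : DPVar S X Y Sh → ℝ) :
    (∑ i, u i • lhs i) z = (toLPPoint u).lagrangian
      (fun s x y sh => u (.inr (.inr (.inr (s, x, y, sh))))) (toDPPoint z) := by
  simp only [lhs, LinearMap.sum_apply, LinearMap.smul_apply, Fintype.sum_sum_type,
    Fintype.sum_prod_type, LinearMap.sub_apply, LinearMap.add_apply, LinearMap.neg_apply,
    LinearMap.proj_apply, smul_eq_mul, mul_neg, Finset.sum_neg_distrib, LPPoint.lagrangian,
    toLPPoint, toDPPoint]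
  ring

theorem sum_mul_rhs (u : DPConstraint S X Y Sh → ℝ) :
    ∑ i, u i * rhs PS PYX κ i = (toLPPoint u).objective PS PYX κ := by
  simp [Fintype.sum_sum_type, Fintype.sum_prod_type, rhs, LPPoint.objective, toLPPoint, mul_comm]

theorem feasible_toLPPoint {u : DPConstraint S X Y Sh → ℝ} (hu : ∀ i, 0 ≤ u i)
    (h : ∑ i, u i • lhs i = objective) : (toLPPoint u).Feasible := by
  refine LPPoint.feasible_of_lagrangian_eq_objective
    (m := fun s x y sh => u (.inr (.inr (.inr (s, x, y, sh))))) (fun q => ?_)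
    (fun _ _ => hu _) (fun _ _ => hu _) (fun _ _ _ _ => hu _) fun _ _ _ _ => hu _
  obtain ⟨z, rfl⟩ := toDPPoint_surjective q
  rw [← sum_smul_lhs_apply, h, objective_apply]

end DPVar

theorem LPPoint.Feasible.exists_nonneg_sum_smul_lhs_eq {p : LPPoint S X Y Sh} (hp : p.Feasible) :
    ∃ u : DPConstraint S X Y Sh → ℝ, (∀ i, 0 ≤ u i) ∧
      ∑ i, u i • DPVar.lhs i = DPVar.objective := by
  refine ⟨fun
    | .inl (s, x) => p.QXS s x
    | .inr (.inl (y, sh)) => p.QShY y sh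
    | .inr (.inr (.inl (s, x, y, sh))) => p.W s x y sh
    | .inr (.inr (.inr (s, x, y, sh))) => 1 - (p.QXS s x + p.QShY y sh - p.W s x y sh),
    ?_, LinearMap.ext fun z => ?_⟩
  · rintro (_ | _ | _ | _)
    exacts [hp.QXS_nonneg _ _, hp.QShY_nonneg _ _, hp.W_nonneg _ _ _ _,
      sub_nonneg.2 (hp.mccormick _ _ _ _)]
  · rw [DPVar.sum_smul_lhs_apply, DPVar.objective_apply, ← hp.lagrangian_eq_objective]
    rfl

theorem exists_dual_feasible_ge {v : ℝ} (hfeas : ∃ p : LPPoint S X Y Sh, p.Feasible)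
    (hv : ∀ p : LPPoint S X Y Sh, p.Feasible → v ≤ p.objective PS PYX κ) :
    ∃ q : DPPoint S X Y Sh, q.Feasible PS PYX κ ∧ v ≤ q.objective := by
  obtain ⟨p, hp⟩ := hfeas
  obtain ⟨z, hz, hvz⟩ := exists_forall_le_and_le_of_forall_le DPVar.lhs DPVar.objective
    (DPVar.rhs PS PYX κ) v hp.exists_nonneg_sum_smul_lhs_eq fun u hu h =>
      DPVar.sum_mul_rhs (κ := κ) u ▸ hv _ (DPVar.feasible_toLPPoint hu h)
  exact ⟨DPVar.toDPPoint z, DPVar.feasible_toDPPoint hz, DPVar.objective_apply z ▸ hvz⟩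

omit [Fintype S] [Fintype Y] in
theorem LPPoint.Feasible.W_le_one {p : LPPoint S X Y Sh} (hp : p.Feasible) (s : S) (x : X) (y : Y)
    (sh : Sh) : p.W s x y sh ≤ 1 :=
  calc p.W s x y sh ≤ ∑ sh', p.W s x y sh' :=
        Finset.single_le_sum (fun sh' _ => hp.W_nonneg s x y sh') (Finset.mem_univ sh)
    _ = p.QXS s x := sub_eq_zero.1 (hp.sum_W_sh x s y)
    _ ≤ ∑ x', p.QXS s x' :=
        Finset.single_le_sum (fun x' _ => hp.QXS_nonneg s x') (Finset.mem_univ x)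
    _ = 1 := hp.sum_QXS s

theorem neg_sum_abs_le_optLP :
    ((-∑ s, ∑ x, ∑ y, ∑ sh, |κ s x y sh * PS s * PYX x y| : ℝ) : EReal) ≤ optLP PS PYX κ := by
  refine le_iInf₂ fun p hp => EReal.coe_le_coe_iff.2 ?_
  simp only [LPPoint.objective, ← Finset.sum_neg_distrib]
  gcongr with s _ x _ y _ sh _
  calc -|κ s x y sh * PS s * PYX x y| ≤ -|κ s x y sh * PS s * PYX x y * p.W s x y sh| := by
        rw [neg_le_neg_iff, abs_mul, abs_of_nonneg (hp.W_nonneg s x y sh)]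
        exact mul_le_of_le_one_right (abs_nonneg _) (hp.W_le_one s x y sh)
    _ ≤ κ s x y sh * PS s * PYX x y * p.W s x y sh := neg_abs_le _

theorem exists_dual_optimum (hfeas : ∃ p : LPPoint S X Y Sh, p.Feasible) :
    ∃ q : DPPoint S X Y Sh, q.Feasible PS PYX κ ∧ optLP PS PYX κ ≤ (q.objective : EReal) := by
  obtain ⟨v, hv⟩ : ∃ v : ℝ, (v : EReal) = optLP PS PYX κ := by
    obtain ⟨p, hp⟩ := hfeas
    refine ⟨_, EReal.coe_toReal ?_ ?_⟩
    · exact ((iInf₂_le p hp).trans_lt (EReal.coe_lt_top _)).ne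
    · exact ((EReal.bot_lt_coe _).trans_le neg_sum_abs_le_optLP).ne'
  obtain ⟨q, hq, hvq⟩ := exists_dual_feasible_ge hfeas fun p hp =>
    EReal.coe_le_coe_iff.1 (hv.trans_le (iInf₂_le p hp))
  exact ⟨q, hq, hv ▸ EReal.coe_le_coe_iff.2 hvq⟩

theorem optLP_eq_optDP (hfeas : ∃ p : LPPoint S X Y Sh, p.Feasible) :
    optLP PS PYX κ = optDP (Sh := Sh) PS PYX κ := by
  obtain ⟨q, hq, hle⟩ := exists_dual_optimum (PS := PS) (PYX := PYX) (κ := κ) hfeas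
  exact le_antisymm (le_iSup₂_of_le q hq hle) optDP_le_optLP

end Duality

/-! ### Mutual information -/

section MutualInfo

theorem log_sum_inequality {ι : Type*} (t : Finset ι) {a b : ι → ℝ} (ha : ∀ i ∈ t, 0 ≤ a i)
    (hb : ∀ i ∈ t, 0 ≤ b i) (hab : ∀ i ∈ t, b i = 0 → a i = 0) :
    (∑ i ∈ t, a i) * Real.log ((∑ i ∈ t, a i) / ∑ i ∈ t, b i) ≤
      ∑ i ∈ t, a i * Real.log (a i / b i) := by
  set B := ∑ i ∈ t, b i
  rcases (Finset.sum_nonneg hb).eq_or_lt' with hB0 | hB0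
  · have ha0 : ∀ i ∈ t, a i = 0 := fun i hi =>
      hab i hi ((Finset.sum_eq_zero_iff_of_nonneg hb).1 hB0 i hi)
    rw [Finset.sum_eq_zero ha0, zero_mul, Finset.sum_eq_zero fun i hi => by rw [ha0 i hi, zero_mul]]
  have hmul : ∀ i ∈ t, b i / B * (a i / b i) = a i / B := fun i hi => by
    rw [mul_comm, ← mul_div_assoc, div_mul_cancel_of_imp (hab i hi)]
  have jensen := Real.convexOn_mul_log.map_sum_le (t := t) (w := fun i => b i / B)
    (p := fun i => a i / b i) (fun i hi => div_nonneg (hb i hi) hB0.le)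
    (by rw [← Finset.sum_div, div_self hB0.ne'])
    (fun i hi => div_nonneg (ha i hi) (hb i hi))
  have hlog : ∑ i ∈ t, b i / B * (a i / b i) * Real.log (a i / b i) =
      (∑ i ∈ t, a i * Real.log (a i / b i)) / B := by
    rw [Finset.sum_div]
    exact Finset.sum_congr rfl fun i hi => by rw [hmul i hi, div_mul_eq_mul_div]
  simp only [smul_eq_mul, ← mul_assoc] at jensen
  rw [Finset.sum_congr rfl hmul, hlog, ← Finset.sum_div, div_mul_eq_mul_div] at jensen
  exact (div_le_div_iff_of_pos_right hB0).1 jensen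

variable {S Sh : Type*} [Fintype S] [Fintype Sh] {PS : S → ℝ} {W : S → Sh → ℝ} {Q : Sh → ℝ}

theorem IsKernel.nonneg {α β : Type*} [Fintype β] {k : α → β → ℝ} (hk : IsKernel k) (a : α)
    (b : β) : 0 ≤ k a b := (hk a).1 b

theorem IsKernel.sum_eq_one {α β : Type*} [Fintype β] {k : α → β → ℝ} (hk : IsKernel k) (a : α) :
    ∑ b, k a b = 1 := (hk a).2

omit [Fintype S] in
theorem convex_setOf_isKernel : Convex ℝ {W : S → Sh → ℝ | IsKernel W} := by
  simpa [Set.pi, IsKernel] using convex_pi (s := Set.univ) fun (_ : S) _ => convex_stdSimplex ℝ Sh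

theorem outputLaw_nonneg (hPS : ∀ s, 0 ≤ PS s) (hW : IsKernel W) (sh : Sh) :
    0 ≤ outputLaw PS W sh :=
  Finset.sum_nonneg fun s _ => mul_nonneg (hPS s) (hW.nonneg s sh)

theorem outputLaw_mem_stdSimplex (hPS : PS ∈ stdSimplex ℝ S) (hW : IsKernel W) :
    outputLaw PS W ∈ stdSimplex ℝ Sh := by
  refine ⟨outputLaw_nonneg hPS.1 hW, ?_⟩
  simp only [outputLaw]
  rw [Finset.sum_comm]
  simp_rw [← Finset.mul_sum, hW.sum_eq_one, mul_one, hPS.2]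

theorem outputLaw_ne_zero (hPS : ∀ s, 0 ≤ PS s) (hW : IsKernel W) {s : S} {sh : Sh}
    (h : PS s * W s sh ≠ 0) : outputLaw PS W sh ≠ 0 := fun h0 =>
  h ((Finset.sum_eq_zero_iff_of_nonneg fun s _ => mul_nonneg (hPS s) (hW.nonneg s sh)).1 h0 s
    (Finset.mem_univ s))

omit [Fintype Sh] in
theorem outputLaw_smul_add_smul (a b : ℝ) (W W' : S → Sh → ℝ) :
    outputLaw PS (a • W + b • W') = a • outputLaw PS W + b • outputLaw PS W' := by
  ext sh
  simp only [outputLaw, Pi.add_apply, Pi.smul_apply, smul_eq_mul, Finset.mul_sum,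
    ← Finset.sum_add_distrib]
  exact Finset.sum_congr rfl fun s _ => by ring

theorem neg_sum_mul_log_sum_le (hPS : ∀ s, 0 ≤ PS s) (hW : IsKernel W) {b : S → Sh → ℝ}
    (hb : ∀ s sh, 0 ≤ b s sh) (hWb : ∀ s sh, PS s * W s sh ≠ 0 → b s sh ≠ 0) :
    -∑ s, PS s * Real.log (∑ sh, b s sh) ≤
      ∑ s, ∑ sh, PS s * W s sh * Real.log (W s sh / b s sh) := by
  rw [← Finset.sum_neg_distrib]
  refine Finset.sum_le_sum fun s _ => ?_
  simp_rw [mul_assoc, ← Finset.mul_sum]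
  by_cases hs : PS s = 0
  · simp [hs]
  have h := log_sum_inequality Finset.univ (fun sh _ => hW.nonneg s sh) (fun sh _ => hb s sh)
    fun sh _ h0 => by_contra fun hw => hWb s sh (mul_ne_zero hs hw) h0
  rw [hW.sum_eq_one, one_div, Real.log_inv, one_mul] at h
  rw [← mul_neg]
  exact mul_le_mul_of_nonneg_left h (hPS s)

theorem mutualInfo_nonneg (hPS : PS ∈ stdSimplex ℝ S) (hW : IsKernel W) : 0 ≤ mutualInfo PS W := by
  simpa [mutualInfo, (outputLaw_mem_stdSimplex hPS hW).2] using
    neg_sum_mul_log_sum_le hPS.1 hW (fun _ => outputLaw_nonneg hPS.1 hW)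
      fun _ _ => outputLaw_ne_zero hPS.1 hW

theorem convexOn_mutualInfo (hPS : ∀ s, 0 ≤ PS s) :
    ConvexOn ℝ {W : S → Sh → ℝ | IsKernel W} (mutualInfo PS) := by
  refine convexOn_iff_forall_pos.2 ⟨convex_setOf_isKernel, fun W hW W' hW' a b ha hb _ => ?_⟩
  simp only [mutualInfo, outputLaw_smul_add_smul, smul_eq_mul, Finset.mul_sum,
    ← Finset.sum_add_distrib, Pi.add_apply, Pi.smul_apply]
  refine Finset.sum_le_sum fun s _ => Finset.sum_le_sum fun sh _ => ?_
  by_cases hs : PS s = 0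
  · simp [hs]
  have hac {W : S → Sh → ℝ} (hW : IsKernel W) {c : ℝ} (hc : 0 < c)
      (h : c * outputLaw PS W sh = 0) : c * W s sh = 0 := by
    by_contra hne
    exact mul_ne_zero hc.ne'
      (outputLaw_ne_zero hPS hW (mul_ne_zero hs (right_ne_zero_of_mul hne))) h
  have h := log_sum_inequality Finset.univ (a := ![a * W s sh, b * W' s sh])
    (b := ![a * outputLaw PS W sh, b * outputLaw PS W' sh])
    (by simp [Fin.forall_fin_two, mul_nonneg, ha.le, hb.le, IsKernel.nonneg hW,
      IsKernel.nonneg hW'])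
    (by simp [Fin.forall_fin_two, mul_nonneg, ha.le, hb.le, outputLaw_nonneg hPS hW,
      outputLaw_nonneg hPS hW'])
    (by simpa only [Fin.forall_fin_two, Finset.mem_univ, true_imp_iff] using
      ⟨hac hW ha, hac hW' hb⟩)
  simp only [Fin.sum_univ_two, Matrix.cons_val_zero, Matrix.cons_val_one,
    mul_div_mul_left _ _ ha.ne', mul_div_mul_left _ _ hb.ne'] at h
  linarith [mul_le_mul_of_nonneg_left h (hPS s)]

/-- The conditional relative entropy `D(W ‖ Q | P_S)` in nats. It is the mutual information when `Q`
is the output law of `W`. -/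
def condRelEntropy (PS : S → ℝ) (W : S → Sh → ℝ) (Q : Sh → ℝ) : ℝ :=
  ∑ s, ∑ sh, PS s * W s sh * Real.log (W s sh / Q sh)

theorem condRelEntropy_eq_mutualInfo_add (hPS : ∀ s, 0 ≤ PS s) (hW : IsKernel W)
    (hWQ : ∀ s sh, PS s * W s sh ≠ 0 → Q sh ≠ 0) :
    condRelEntropy PS W Q =
      mutualInfo PS W + ∑ sh, outputLaw PS W sh * Real.log (outputLaw PS W sh / Q sh) := by
  have hsum : ∑ sh, outputLaw PS W sh * Real.log (outputLaw PS W sh / Q sh) =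
      ∑ s, ∑ sh, PS s * W s sh * Real.log (outputLaw PS W sh / Q sh) := by
    rw [Finset.sum_comm]
    simp_rw [← Finset.sum_mul]
    rfl
  rw [hsum, condRelEntropy, mutualInfo]
  simp_rw [← Finset.sum_add_distrib]
  refine Finset.sum_congr rfl fun s _ => Finset.sum_congr rfl fun sh _ => ?_
  by_cases h : PS s * W s sh = 0
  · simp [h]
  have hw := right_ne_zero_of_mul h
  have hq := outputLaw_ne_zero hPS hW h
  rw [Real.log_div hw (hWQ s sh h), Real.log_div hw hq, Real.log_div hq (hWQ s sh h)]
  ring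

theorem mutualInfo_le_condRelEntropy (hPS : PS ∈ stdSimplex ℝ S) (hW : IsKernel W)
    (hQ : Q ∈ stdSimplex ℝ Sh) (hWQ : ∀ s sh, PS s * W s sh ≠ 0 → Q sh ≠ 0) :
    mutualInfo PS W ≤ condRelEntropy PS W Q := by
  have hq := outputLaw_mem_stdSimplex hPS hW
  have hac (sh : Sh) (h : Q sh = 0) : outputLaw PS W sh = 0 :=
    Finset.sum_eq_zero fun s _ => by_contra fun hne => hWQ s sh hne h
  have h := log_sum_inequality Finset.univ (fun sh _ => hq.1 sh) (fun sh _ => hQ.1 sh)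
    fun sh _ => hac sh
  rw [hq.2, hQ.2, div_one, Real.log_one, mul_zero] at h
  rw [condRelEntropy_eq_mutualInfo_add hPS.1 hW hWQ]
  exact le_add_of_nonneg_right h

end MutualInfo

/-! ### The rate-distortion function -/

section RateDistortion

open Filter Topology

variable {S Sh : Type*} [Fintype S] [Fintype Sh] {PS : S → ℝ} {d : S → Sh → ℝ≥0∞}
  {W W' : S → Sh → ℝ} {D D' dd : ℝ}

/-- The expected distortion as a real number. Infinite distortions count as `0`, so that it agrees
with `expDistortion` only under `FiniteDistortion`. -/
def realDistortion (PS : S → ℝ) (d : S → Sh → ℝ≥0∞) (W : S → Sh → ℝ) : ℝ :=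
  ∑ s, ∑ sh, PS s * W s sh * (d s sh).toReal

/-- The distortion is almost surely finite. -/
def FiniteDistortion (PS : S → ℝ) (d : S → Sh → ℝ≥0∞) (W : S → Sh → ℝ) : Prop :=
  ∀ s sh, PS s * W s sh ≠ 0 → d s sh ≠ ⊤

theorem realDistortion_nonneg (hPS : ∀ s, 0 ≤ PS s) (hW : IsKernel W) :
    0 ≤ realDistortion PS d W :=
  Finset.sum_nonneg fun s _ => Finset.sum_nonneg fun sh _ =>
    mul_nonneg (mul_nonneg (hPS s) (hW.nonneg s sh)) ENNReal.toReal_nonneg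

theorem realDistortion_smul_add_smul (a b : ℝ) (W W' : S → Sh → ℝ) :
    realDistortion PS d (a • W + b • W') =
      a * realDistortion PS d W + b * realDistortion PS d W' := by
  simp only [realDistortion, Pi.add_apply, Pi.smul_apply, smul_eq_mul, Finset.mul_sum,
    ← Finset.sum_add_distrib]
  exact Finset.sum_congr rfl fun s _ => Finset.sum_congr rfl fun sh _ => by ring

omit [Fintype S] [Fintype Sh] in
theorem FiniteDistortion.smul_add_smul (hW : FiniteDistortion PS d W)
    (hW' : FiniteDistortion PS d W') (a b : ℝ) : FiniteDistortion PS d (a • W + b • W') := by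
  intro s sh h hd
  have h₁ : PS s * W s sh = 0 := by_contra fun hne => hW s sh hne hd
  have h₂ : PS s * W' s sh = 0 := by_contra fun hne => hW' s sh hne hd
  simp only [Pi.add_apply, Pi.smul_apply, smul_eq_mul] at h
  exact h (by linear_combination a * h₁ + b * h₂)

theorem FiniteDistortion.expDistortion_eq_ofReal (hPS : ∀ s, 0 ≤ PS s) (hW : IsKernel W)
    (hf : FiniteDistortion PS d W) :
    expDistortion PS d W = ENNReal.ofReal (realDistortion PS d W) := by
  have hPW (s : S) (sh : Sh) : 0 ≤ PS s * W s sh := mul_nonneg (hPS s) (hW.nonneg s sh)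
  have hterm (s : S) (sh : Sh) : 0 ≤ PS s * W s sh * (d s sh).toReal :=
    mul_nonneg (hPW s sh) ENNReal.toReal_nonneg
  rw [realDistortion,
    ENNReal.ofReal_sum_of_nonneg fun s _ => Finset.sum_nonneg fun sh _ => hterm s sh]
  refine Finset.sum_congr rfl fun s _ => ?_
  rw [ENNReal.ofReal_sum_of_nonneg fun sh _ => hterm s sh]
  refine Finset.sum_congr rfl fun sh _ => ?_
  rw [ENNReal.ofReal_mul (hPW s sh)]
  by_cases h : PS s * W s sh = 0
  · simp [h]
  · rw [ENNReal.ofReal_toReal (hf s sh h)]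

theorem finiteDistortion_of_expDistortion_ne_top (hPS : ∀ s, 0 ≤ PS s) (hW : IsKernel W)
    (h : expDistortion PS d W ≠ ⊤) : FiniteDistortion PS d W := by
  intro s sh hne hd
  have hterm := ENNReal.sum_ne_top.1 (ENNReal.sum_ne_top.1 h s (Finset.mem_univ s)) sh
    (Finset.mem_univ sh)
  have hpos : 0 < PS s * W s sh := (mul_nonneg (hPS s) (hW.nonneg s sh)).lt_of_ne hne.symm
  rw [hd, ENNReal.mul_top (ENNReal.ofReal_pos.2 hpos).ne'] at hterm
  exact hterm rfl

theorem mem_admissible_iff (hPS : ∀ s, 0 ≤ PS s) : W ∈ admissible PS d D ↔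
    IsKernel W ∧ FiniteDistortion PS d W ∧ realDistortion PS d W ≤ D := by
  refine and_congr_right fun hW => ?_
  have le_iff (hf : FiniteDistortion PS d W) :
      (expDistortion PS d W : EReal) ≤ D ↔ realDistortion PS d W ≤ D := by
    rw [hf.expDistortion_eq_ofReal hPS hW, EReal.coe_ennreal_ofReal,
      max_eq_left (realDistortion_nonneg hPS hW), EReal.coe_le_coe_iff]
  refine ⟨fun h => ?_, fun ⟨hf, h⟩ => (le_iff hf).2 h⟩
  have hf : FiniteDistortion PS d W :=
    finiteDistortion_of_expDistortion_ne_top hPS hW fun htop => by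
      rw [htop] at h
      exact EReal.coe_ne_top D (top_le_iff.1 h)
  exact ⟨hf, (le_iff hf).1 h⟩

theorem smul_add_smul_mem_admissible (hPS : ∀ s, 0 ≤ PS s) (hW : W ∈ admissible PS d D)
    (hW' : W' ∈ admissible PS d D') {a b : ℝ} (ha : 0 ≤ a) (hb : 0 ≤ b) (hab : a + b = 1) :
    a • W + b • W' ∈ admissible PS d (a * D + b * D') := by
  rw [mem_admissible_iff hPS] at hW hW' ⊢
  refine ⟨convex_setOf_isKernel hW.1 hW'.1 ha hb hab, hW.2.1.smul_add_smul hW'.2.1 a b, ?_⟩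
  rw [realDistortion_smul_add_smul]
  exact add_le_add (mul_le_mul_of_nonneg_left hW.2.2 ha) (mul_le_mul_of_nonneg_left hW'.2.2 hb)

theorem dMin_nonneg (hPS : ∀ s, 0 ≤ PS s) : 0 ≤ dMin PS d := by
  refine le_sInf ?_
  rintro _ ⟨D, hD, rfl⟩
  simp only [Set.mem_ofPred_eq, rateDistortion, iInf_lt_iff] at hD
  obtain ⟨W, hW, -⟩ := hD
  obtain ⟨hK, -, hle⟩ := (mem_admissible_iff hPS).1 hW
  exact EReal.coe_nonneg.2 ((realDistortion_nonneg hPS hK).trans hle)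

theorem realRate_le_mutualInfo (hPS : PS ∈ stdSimplex ℝ S) (hW : W ∈ admissible PS d D) :
    realRate PS d D ≤ mutualInfo PS W := by
  have hnonneg : 0 ≤ rateDistortion PS d D := le_iInf₂ fun W hW =>
    EReal.coe_nonneg.2 (mutualInfo_nonneg hPS hW.1)
  exact EReal.toReal_le_toReal (iInf₂_le W hW) (ne_bot_of_le_ne_bot EReal.zero_ne_bot hnonneg)
    (EReal.coe_ne_top _)

theorem AttainsRate.realRate_eq (hW : AttainsRate PS d D W) :
    realRate PS d D = mutualInfo PS W := by
  rw [realRate, ← hW.2, EReal.toReal_coe]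

theorem le_of_hasDerivAt_of_le_add_mul {g : ℝ → ℝ} {g' C : ℝ} (hg : HasDerivAt g g' 0)
    (h : ∀ t ∈ Set.Ioo (0 : ℝ) 1, g t ≤ g 0 + t * C) : g' ≤ C := by
  refine le_of_tendsto hg.tendsto_slope_zero_right ?_
  filter_upwards [Ioo_mem_nhdsGT zero_lt_one] with t ht
  rw [smul_eq_mul, zero_add, inv_mul_le_iff₀ ht.1]
  linarith [h t ht]

theorem AttainsRate.deriv_mul_le (hPS : PS ∈ stdSimplex ℝ S) (hW : AttainsRate PS d dd W)
    (hd : DifferentiableAt ℝ (realRate PS d) dd) (hW' : W' ∈ admissible PS d D) :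
    deriv (realRate PS d) dd * (D - dd) ≤ mutualInfo PS W' - mutualInfo PS W := by
  have hline : HasDerivAt (fun t : ℝ => dd + t * (D - dd)) (D - dd) 0 := by
    simpa using ((hasDerivAt_id (0 : ℝ)).mul_const (D - dd)).const_add dd
  have hrate : HasDerivAt (realRate PS d) (deriv (realRate PS d) dd) (dd + 0 * (D - dd)) := by
    simpa using hd.hasDerivAt
  refine le_of_hasDerivAt_of_le_add_mul (hrate.comp 0 hline) fun t ht => ?_
  have hadm := smul_add_smul_mem_admissible hPS.1 hW.1 hW' (sub_nonneg.2 ht.2.le) ht.1.le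
    (sub_add_cancel 1 t)
  have hconv := (convexOn_mutualInfo hPS.1).2 hW.1.1 hW'.1 (sub_nonneg.2 ht.2.le) ht.1.le
    (sub_add_cancel 1 t)
  simp only [Function.comp_apply, zero_mul, add_zero, hW.realRate_eq]
  calc
    realRate PS d (dd + t * (D - dd)) = realRate PS d ((1 - t) * dd + t * D) := by ring_nf
    _ ≤ mutualInfo PS ((1 - t) • W + t • W') := realRate_le_mutualInfo hPS hadm
    _ ≤ (1 - t) * mutualInfo PS W + t * mutualInfo PS W' := hconv
    _ = mutualInfo PS W + t * (mutualInfo PS W' - mutualInfo PS W) := by ring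

theorem AttainsRate.lamStar_nonneg (hPS : PS ∈ stdSimplex ℝ S) (hW : AttainsRate PS d dd W)
    (hd : DifferentiableAt ℝ (realRate PS d) dd) : 0 ≤ lamStar PS d dd := by
  obtain ⟨hK, hf, hle⟩ := (mem_admissible_iff hPS.1).1 hW.1
  have h := hW.deriv_mul_le hPS hd
    ((mem_admissible_iff hPS.1).2 ⟨hK, hf, hle.trans (lt_add_one dd).le⟩)
  rw [lamStar]
  linarith

end RateDistortion

/-! ### Exponential tilting -/

section Tilting

variable {S Sh : Type*} [Fintype S] [Fintype Sh] {PS : S → ℝ} {d : S → Sh → ℝ≥0∞}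
  {W : S → Sh → ℝ} {Q : Sh → ℝ} {l dd : ℝ}

theorem tiltWeight_nonneg (l dd : ℝ) (δ : ℝ≥0∞) : 0 ≤ tiltWeight l dd δ := by
  rw [tiltWeight]
  split_ifs
  exacts [le_rfl, (Real.exp_pos _).le]

theorem tiltWeight_eq_zero_iff {δ : ℝ≥0∞} : tiltWeight l dd δ = 0 ↔ δ = ⊤ := by
  rw [tiltWeight]
  split_ifs with h <;> simp [h]

theorem log_tiltWeight {δ : ℝ≥0∞} (h : δ ≠ ⊤) :
    Real.log (tiltWeight l dd δ) = l * dd - l * δ.toReal := by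
  rw [tiltWeight, if_neg h, Real.log_exp]

theorem ind_le_tiltWeight (hl : 0 ≤ l) (hdd : 0 ≤ dd) (δ : ℝ≥0∞) :
    ind (δ ≤ ENNReal.ofReal dd) ≤ tiltWeight l dd δ := by
  rw [ind]
  split_ifs with h
  · rw [tiltWeight, if_neg (ne_top_of_le_ne_top ENNReal.ofReal_ne_top h), Real.one_le_exp_iff,
      sub_nonneg]
    exact mul_le_mul_of_nonneg_left (ENNReal.toReal_le_of_le_ofReal hdd h) hl
  · exact tiltWeight_nonneg _ _ _

/-- The expectation `E[exp(l 𝐝 - l d(s,Ŝ))]` when `Ŝ` has law `Q`. -/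
def tiltMean (d : S → Sh → ℝ≥0∞) (l dd : ℝ) (Q : Sh → ℝ) (s : S) : ℝ :=
  ∑ sh, Q sh * tiltWeight l dd (d s sh)

open Classical in
/-- The conditional distribution obtained from `Q` by exponential tilting; at letters `s` where the
normalizing constant vanishes it is `Q` itself. -/
def tiltKernel (d : S → Sh → ℝ≥0∞) (l dd : ℝ) (Q : Sh → ℝ) (s : S) (sh : Sh) : ℝ :=
  if tiltMean d l dd Q s = 0 then Q sh
  else Q sh * tiltWeight l dd (d s sh) / tiltMean d l dd Q s

omit [Fintype S] in
theorem tiltMean_nonneg (hQ : ∀ sh, 0 ≤ Q sh) (s : S) : 0 ≤ tiltMean d l dd Q s :=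
  Finset.sum_nonneg fun sh _ => mul_nonneg (hQ sh) (tiltWeight_nonneg _ _ _)

omit [Fintype S] in
theorem tiltMean_smul_add_smul (a b : ℝ) (Q Q' : Sh → ℝ) (s : S) :
    tiltMean d l dd (a • Q + b • Q') s = a * tiltMean d l dd Q s + b * tiltMean d l dd Q' s := by
  simp only [tiltMean, Pi.add_apply, Pi.smul_apply, smul_eq_mul, add_mul, mul_assoc,
    Finset.sum_add_distrib, Finset.mul_sum]

omit [Fintype S] in
theorem tiltMean_single [DecidableEq Sh] (sh : Sh) (s : S) :
    tiltMean d l dd (Pi.single sh 1) s = tiltWeight l dd (d s sh) := by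
  simp [tiltMean, Pi.single_apply]

theorem tiltMean_outputLaw_pos (hPS : ∀ s, 0 ≤ PS s) (hW : IsKernel W)
    (hf : FiniteDistortion PS d W) {s : S} (hs : PS s ≠ 0) :
    0 < tiltMean d l dd (outputLaw PS W) s := by
  obtain ⟨sh, hsh⟩ : ∃ sh, W s sh ≠ 0 := by
    by_contra! h
    simpa [h] using hW.sum_eq_one s
  have hne : PS s * W s sh ≠ 0 := mul_ne_zero hs hsh
  have hpos : 0 < outputLaw PS W sh * tiltWeight l dd (d s sh) :=
    mul_pos ((outputLaw_nonneg hPS hW sh).lt_of_ne' (outputLaw_ne_zero hPS hW hne))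
      ((tiltWeight_nonneg _ _ _).lt_of_ne' fun h => hf s sh hne (tiltWeight_eq_zero_iff.1 h))
  exact hpos.trans_le (Finset.single_le_sum (f := fun sh => outputLaw PS W sh * _)
    (fun sh _ => mul_nonneg (outputLaw_nonneg hPS hW sh) (tiltWeight_nonneg _ _ _))
    (Finset.mem_univ sh))

omit [Fintype S] in
theorem isKernel_tiltKernel (hQ : Q ∈ stdSimplex ℝ Sh) : IsKernel (tiltKernel d l dd Q) := by
  intro s
  by_cases ha : tiltMean d l dd Q s = 0
  · have hs : tiltKernel d l dd Q s = Q := funext fun sh => if_pos ha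
    rwa [hs]
  · have hs : tiltKernel d l dd Q s =
        fun sh => Q sh * tiltWeight l dd (d s sh) / tiltMean d l dd Q s :=
      funext fun sh => if_neg ha
    rw [hs]
    refine ⟨fun sh => div_nonneg (mul_nonneg (hQ.1 sh) (tiltWeight_nonneg _ _ _))
      (tiltMean_nonneg hQ.1 s), ?_⟩
    rw [← Finset.sum_div]
    exact div_self ha

omit [Fintype S] in
theorem ne_zero_and_ne_top_of_tiltKernel_ne_zero {s : S} {sh : Sh}
    (ha : tiltMean d l dd Q s ≠ 0) (h : tiltKernel d l dd Q s sh ≠ 0) :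
    Q sh ≠ 0 ∧ d s sh ≠ ⊤ := by
  rw [tiltKernel, if_neg ha] at h
  have hmul : Q sh * tiltWeight l dd (d s sh) ≠ 0 := fun h0 => h (by rw [h0, zero_div])
  exact ⟨left_ne_zero_of_mul hmul,
    fun htop => right_ne_zero_of_mul hmul (tiltWeight_eq_zero_iff.2 htop)⟩

theorem condRelEntropy_add_mul_sub (hPS : PS ∈ stdSimplex ℝ S) (hW : IsKernel W)
    (hf : FiniteDistortion PS d W) (hWQ : ∀ s sh, PS s * W s sh ≠ 0 → Q sh ≠ 0) :
    condRelEntropy PS W Q + l * (realDistortion PS d W - dd) =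
      ∑ s, ∑ sh, PS s * W s sh * Real.log (W s sh / (Q sh * tiltWeight l dd (d s sh))) := by
  have hdist : l * (realDistortion PS d W - dd) =
      ∑ s, ∑ sh, PS s * W s sh * (l * (d s sh).toReal - l * dd) := by
    simp only [mul_sub, Finset.sum_sub_distrib, realDistortion, ← Finset.mul_sum, ← Finset.sum_mul,
      hW.sum_eq_one, mul_one, hPS.2, one_mul, mul_left_comm _ l]
  rw [hdist, condRelEntropy]
  simp_rw [← Finset.sum_add_distrib]
  refine Finset.sum_congr rfl fun s _ => Finset.sum_congr rfl fun sh _ => ?_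
  by_cases h : PS s * W s sh = 0
  · simp [h]
  have hw := right_ne_zero_of_mul h
  have hd := hf s sh h
  rw [← div_div, Real.log_div (div_ne_zero hw (hWQ s sh h)) (tiltWeight_eq_zero_iff.not.2 hd),
    log_tiltWeight hd]
  ring

theorem neg_sum_mul_log_tiltMean_le (hPS : PS ∈ stdSimplex ℝ S) (hW : IsKernel W)
    (hf : FiniteDistortion PS d W) (hQ : ∀ sh, 0 ≤ Q sh)
    (hWQ : ∀ s sh, PS s * W s sh ≠ 0 → Q sh ≠ 0) :
    -∑ s, PS s * Real.log (tiltMean d l dd Q s) ≤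
      condRelEntropy PS W Q + l * (realDistortion PS d W - dd) := by
  rw [condRelEntropy_add_mul_sub hPS hW hf hWQ]
  exact neg_sum_mul_log_sum_le hPS.1 hW
    (fun s sh => mul_nonneg (hQ sh) (tiltWeight_nonneg l dd (d s sh)))
    fun s sh h => mul_ne_zero (hWQ s sh h) (tiltWeight_eq_zero_iff.not.2 (hf s sh h))

theorem condRelEntropy_tiltKernel_add (hPS : PS ∈ stdSimplex ℝ S) (hQ : Q ∈ stdSimplex ℝ Sh)
    (ha : ∀ s, PS s ≠ 0 → tiltMean d l dd Q s ≠ 0) :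
    condRelEntropy PS (tiltKernel d l dd Q) Q +
        l * (realDistortion PS d (tiltKernel d l dd Q) - dd) =
      -∑ s, PS s * Real.log (tiltMean d l dd Q s) := by
  have hac {s : S} {sh : Sh} (h : PS s * tiltKernel d l dd Q s sh ≠ 0) :
      Q sh ≠ 0 ∧ d s sh ≠ ⊤ :=
    ne_zero_and_ne_top_of_tiltKernel_ne_zero (ha s (left_ne_zero_of_mul h))
      (right_ne_zero_of_mul h)
  have hK : IsKernel (tiltKernel d l dd Q) := isKernel_tiltKernel hQ
  rw [condRelEntropy_add_mul_sub hPS hK (fun s sh h => (hac h).2) fun s sh h => (hac h).1,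
    ← Finset.sum_neg_distrib]
  refine Finset.sum_congr rfl fun s _ => ?_
  have hterm (sh : Sh) : PS s * tiltKernel d l dd Q s sh *
        Real.log (tiltKernel d l dd Q s sh / (Q sh * tiltWeight l dd (d s sh))) =
      tiltKernel d l dd Q s sh * -(PS s * Real.log (tiltMean d l dd Q s)) := by
    by_cases h : PS s * tiltKernel d l dd Q s sh = 0
    · rcases mul_eq_zero.1 h with hs | hw <;> simp [*]
    have hb : Q sh * tiltWeight l dd (d s sh) ≠ 0 :=
      mul_ne_zero (hac h).1 (tiltWeight_eq_zero_iff.not.2 (hac h).2)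
    have hratio : tiltKernel d l dd Q s sh / (Q sh * tiltWeight l dd (d s sh)) =
        (tiltMean d l dd Q s)⁻¹ := by
      rw [tiltKernel, if_neg (ha s (left_ne_zero_of_mul h)), div_right_comm, div_self hb, one_div]
    rw [hratio, Real.log_inv]
    ring
  simp_rw [hterm, ← Finset.sum_mul, hK.sum_eq_one, one_mul]

theorem AttainsRate.sum_mul_log_tiltMean_le (hPS : PS ∈ stdSimplex ℝ S)
    (hW : AttainsRate PS d dd W) (hd : DifferentiableAt ℝ (realRate PS d) dd)
    (hQ : Q ∈ stdSimplex ℝ Sh) (ha : ∀ s, PS s ≠ 0 → tiltMean d (lamStar PS d dd) dd Q s ≠ 0) :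
    ∑ s, PS s * Real.log (tiltMean d (lamStar PS d dd) dd Q s) ≤
      ∑ s, PS s * Real.log (tiltMean d (lamStar PS d dd) dd (outputLaw PS W) s) := by
  set l := lamStar PS d dd with hl
  set W' := tiltKernel d l dd Q
  have hW' : IsKernel W' := isKernel_tiltKernel hQ
  have hac (s : S) (sh : Sh) (h : PS s * W' s sh ≠ 0) : Q sh ≠ 0 ∧ d s sh ≠ ⊤ :=
    ne_zero_and_ne_top_of_tiltKernel_ne_zero (ha s (left_ne_zero_of_mul h))
      (right_ne_zero_of_mul h)
  obtain ⟨hK, hf, hD⟩ := (mem_admissible_iff hPS.1).1 hW.1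
  have htangent := hW.deriv_mul_le hPS hd
    ((mem_admissible_iff hPS.1).2 ⟨hW', fun s sh h => (hac s sh h).2, le_rfl⟩)
  rw [← neg_neg (deriv _ _), ← lamStar, ← hl] at htangent
  refine neg_le_neg_iff.1 ?_
  calc
    -∑ s, PS s * Real.log (tiltMean d l dd (outputLaw PS W) s)
      ≤ mutualInfo PS W + l * (realDistortion PS d W - dd) :=
        neg_sum_mul_log_tiltMean_le hPS hK hf (outputLaw_nonneg hPS.1 hK)
          fun s sh => outputLaw_ne_zero hPS.1 hK
    _ ≤ mutualInfo PS W :=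
        add_le_of_nonpos_right
          (mul_nonpos_of_nonneg_of_nonpos (hW.lamStar_nonneg hPS hd) (sub_nonpos.2 hD))
    _ ≤ mutualInfo PS W' + l * (realDistortion PS d W' - dd) := by linarith
    _ ≤ condRelEntropy PS W' Q + l * (realDistortion PS d W' - dd) := by
        gcongr
        exact mutualInfo_le_condRelEntropy hPS hW' hQ fun s sh h => (hac s sh h).1
    _ = -∑ s, PS s * Real.log (tiltMean d l dd Q s) := condRelEntropy_tiltKernel_add hPS hQ ha

theorem hasDerivAt_sum_mul_log_add_mul {ι : Type*} (t : Finset ι) {p a b : ι → ℝ}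
    (ha : ∀ i ∈ t, p i ≠ 0 → a i ≠ 0) :
    HasDerivAt (fun ε => ∑ i ∈ t, p i * Real.log (a i + ε * b i))
      (∑ i ∈ t, p i * (b i / a i)) 0 := by
  refine HasDerivAt.fun_sum fun i hi => ?_
  by_cases hp : p i = 0
  · simpa [hp] using hasDerivAt_const (0 : ℝ) (0 : ℝ)
  have hline : HasDerivAt (fun ε => a i + ε * b i) (b i) 0 := by
    simpa using ((hasDerivAt_id (0 : ℝ)).mul_const (b i)).const_add (a i)
  simpa using (hline.log (by simpa using ha i hi hp)).const_mul (p i)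

/- Moving the output law from the optimal one towards the point mass at `sh` cannot increase
`∑ s, PS s * log (tiltMean …)`. The inequality is the sign of the derivative. -/
theorem AttainsRate.sum_mul_tiltWeight_div_le_one (hPS : PS ∈ stdSimplex ℝ S)
    (hW : AttainsRate PS d dd W) (hd : DifferentiableAt ℝ (realRate PS d) dd) (sh : Sh) :
    ∑ s, PS s * (tiltWeight (lamStar PS d dd) dd (d s sh) /
      tiltMean d (lamStar PS d dd) dd (outputLaw PS W) s) ≤ 1 := by
  classical
  obtain ⟨hK, hf, -⟩ := (mem_admissible_iff hPS.1).1 hW.1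
  set φ : S → ℝ := fun s => tiltWeight (lamStar PS d dd) dd (d s sh)
  set a : S → ℝ := tiltMean d (lamStar PS d dd) dd (outputLaw PS W) with ha_def
  have ha {s : S} (hs : PS s ≠ 0) : 0 < a s := tiltMean_outputLaw_pos hPS.1 hK hf hs
  have hmix (t : ℝ) (s : S) :
      tiltMean d (lamStar PS d dd) dd ((1 - t) • outputLaw PS W + t • Pi.single sh 1) s =
        a s + t * (φ s - a s) := by
    rw [tiltMean_smul_add_smul, tiltMean_single]
    ring
  have hslope : ∑ s, PS s * ((φ s - a s) / a s) ≤ 0 := by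
    refine le_of_hasDerivAt_of_le_add_mul
      (hasDerivAt_sum_mul_log_add_mul Finset.univ fun s _ hs => (ha hs).ne') fun t ht => ?_
    have hpos {s : S} (hs : PS s ≠ 0) : 0 < a s + t * (φ s - a s) := by
      nlinarith [mul_pos (sub_pos.2 ht.2) (ha hs),
        mul_nonneg ht.1.le (tiltWeight_nonneg (lamStar PS d dd) dd (d s sh))]
    simpa only [hmix, ← ha_def, zero_mul, mul_zero, add_zero] using
      hW.sum_mul_log_tiltMean_le hPS hd
        (convex_stdSimplex ℝ Sh (outputLaw_mem_stdSimplex hPS hK) (single_mem_stdSimplex ℝ sh)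
          (sub_nonneg.2 ht.2.le) ht.1.le (sub_add_cancel 1 t))
        fun s hs => (hmix t s).trans_ne (hpos hs).ne'
  have hsub (s : S) : PS s * ((φ s - a s) / a s) = PS s * (φ s / a s) - PS s := by
    by_cases hs : PS s = 0
    · simp [hs]
    rw [sub_div, div_self (ha hs).ne', mul_sub, mul_one]
  simp only [hsub, Finset.sum_sub_distrib, hPS.2] at hslope
  linarith

theorem AttainsRate.sum_exp_tiltedInfo_le_one (hPS : PS ∈ stdSimplex ℝ S)
    (hW : AttainsRate PS d dd W) (hd : DifferentiableAt ℝ (realRate PS d) dd) (hdd : 0 < dd)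
    (sh : Sh) :
    ∑ s, PS s * Real.exp (tiltedInfo PS d dd W s) * ind (d s sh ≤ ENNReal.ofReal dd) ≤ 1 := by
  obtain ⟨hK, hf, -⟩ := (mem_admissible_iff hPS.1).1 hW.1
  refine le_trans (Finset.sum_le_sum fun s _ => ?_) (hW.sum_mul_tiltWeight_div_le_one hPS hd sh)
  by_cases hs : PS s = 0
  · simp [hs]
  have ha : 0 < tiltMean d (lamStar PS d dd) dd (outputLaw PS W) s :=
    tiltMean_outputLaw_pos hPS.1 hK hf hs
  have hexp : Real.exp (tiltedInfo PS d dd W s) =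
      1 / tiltMean d (lamStar PS d dd) dd (outputLaw PS W) s := by
    rw [tiltedInfo, if_neg hdd.ne']
    exact Real.exp_log (one_div_pos.2 ha)
  rw [hexp, mul_assoc, one_div_mul_eq_div]
  exact mul_le_mul_of_nonneg_left (div_le_div_of_nonneg_right
    (ind_le_tiltWeight (hW.lamStar_nonneg hPS hd) hdd.le _) ha.le) (hPS.1 s)

theorem sum_exp_tiltedInfo_zero_le_one (hPS : ∀ s, 0 ≤ PS s) {sh : Sh}
    (hsub : {s | 0 < PS s ∧ d s sh = 0}.Subsingleton) :
    ∑ s, PS s * Real.exp (tiltedInfo PS d 0 W s) * ind (d s sh ≤ ENNReal.ofReal 0) ≤ 1 := by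
  classical
  have hterm (s : S) : PS s * Real.exp (tiltedInfo PS d 0 W s) * ind (d s sh ≤ ENNReal.ofReal 0) =
      if 0 < PS s ∧ d s sh = 0 then 1 else 0 := by
    by_cases hs : PS s = 0
    · simp [hs]
    have hpos : 0 < PS s := (hPS s).lt_of_ne' hs
    rw [tiltedInfo, if_pos rfl, Real.exp_log (one_div_pos.2 hpos), ind]
    simp [hs, hpos]
  simp_rw [hterm, Finset.sum_boole]
  exact_mod_cast Finset.card_le_one.2 fun s hs s' hs' =>
    hsub (Finset.mem_filter.1 hs).2 (Finset.mem_filter.1 hs').2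

theorem TiltedSetting.sum_exp_tiltedInfo_le_one (hPS : PS ∈ stdSimplex ℝ S)
    (hT : TiltedSetting PS d dd W) (sh : Sh) :
    ∑ s, PS s * Real.exp (tiltedInfo PS d dd W s) * ind (d s sh ≤ ENNReal.ofReal dd) ≤ 1 := by
  rcases hT with ⟨hmin, hW, hd⟩ | ⟨rfl, hsub⟩
  · have hdd : 0 < dd := EReal.coe_pos.1 ((dMin_nonneg hPS.1).trans_lt hmin)
    exact hW.sum_exp_tiltedInfo_le_one hPS hd hdd sh
  · exact sum_exp_tiltedInfo_zero_le_one hPS.1 (hsub sh)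

end Tilting

/-! ### The explicit point of DP -/

section DualPoint

variable {S X Y Sh : Type*} [Fintype Y] {PS : S → ℝ} {PYX : X → Y → ℝ} {d : S → Sh → ℝ≥0∞}
  {dd : ℝ} {j : S → ℝ} {T : ℕ}

theorem IsKernel.le_one {α β : Type*} [Fintype β] {k : α → β → ℝ} (hk : IsKernel k) (a : α)
    (b : β) : k a b ≤ 1 := by
  rw [← hk.sum_eq_one a]
  exact Finset.single_le_sum (fun b _ => hk.nonneg a b) (Finset.mem_univ b)

theorem ind_nonneg (p : Prop) : 0 ≤ ind p := by
  rw [ind]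
  split_ifs
  exacts [zero_le_one, le_rfl]

theorem ind_eq_one {p : Prop} (h : p) : ind p = 1 := if_pos h

theorem ind_eq_zero {p : Prop} (h : ¬p) : ind p = 0 := if_neg h

theorem le_sub_infoDensity_iff (A : Auxiliary PYX T) (j γ : ℝ) (x : X) (y : Y) (t : Fin T) :
    (γ : EReal) ≤ (j : EReal) - infoDensity A x y t ↔
      A.PYXV x t y ≤ A.Pbar t y * Real.exp (j - γ) := by
  rw [infoDensity]
  rcases ((A.isKernel_PYXV x).nonneg t y).eq_or_lt with hu | hu
  · rw [← hu, ENNReal.ofReal_zero, ENNReal.zero_div, ENNReal.log_zero, EReal.coe_sub_bot]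
    exact iff_of_true le_top (mul_nonneg (A.isKernel_Pbar.nonneg t y) (Real.exp_pos _).le)
  rcases (A.isKernel_Pbar.nonneg t y).eq_or_lt with hv | hv
  · rw [← hv, ENNReal.ofReal_zero, ENNReal.div_zero (ENNReal.ofReal_pos.2 hu).ne',
      ENNReal.log_top, sub_eq_add_neg, EReal.neg_top, EReal.add_bot, zero_mul]
    exact iff_of_false (not_le.2 (EReal.bot_lt_coe γ)) (not_le.2 hu)
  · rw [← ENNReal.ofReal_div_of_pos hv, ENNReal.log_ofReal_of_pos (div_pos hu hv),
      ← EReal.coe_sub, EReal.coe_le_coe_iff, le_sub_comm, Real.log_le_iff_le_exp (div_pos hu hv),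
      div_le_iff₀ hv, mul_comm]

theorem extraTerm_nonneg (A : Auxiliary PYX T) (j γ : ℝ) (x : X) : 0 ≤ extraTerm A j γ x :=
  mul_nonneg (Real.exp_pos _).le <| Finset.sum_nonneg fun y _ => Finset.sum_nonneg fun t _ =>
    mul_nonneg (mul_nonneg (A.isKernel_PVX.nonneg x t) (A.isKernel_Pbar.nonneg t y)) (ind_nonneg _)

theorem sum_dualLamB (A : Auxiliary PYX T) (γ : ℝ) (x : X) (s : S) :
    ∑ y, dualLamB PS j A γ x s y = PS s * (probGe A (j s) γ x + extraTerm A (j s) γ x) := by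
  simp only [dualLamB, probGe, extraTerm, Finset.mul_sum, ← Finset.sum_add_distrib, ← not_le,
    le_sub_infoDensity_iff]
  exact Finset.sum_congr rfl fun y _ => Finset.sum_congr rfl fun t _ => by ring

theorem dualLamB_eq_sum_min (A : Auxiliary PYX T) (γ : ℝ) (x : X) (s : S) (y : Y) :
    dualLamB PS j A γ x s y =
      PS s * ∑ t, min (A.PYXV x t y) (A.Pbar t y * Real.exp (j s - γ)) * A.PVX x t := by
  rw [dualLamB]
  congr 1
  refine Finset.sum_congr rfl fun t _ => ?_
  rcases le_or_gt (A.PYXV x t y) (A.Pbar t y * Real.exp (j s - γ)) with h | h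
  · rw [ind_eq_one h, ind_eq_zero h.not_gt, min_eq_left h]
    ring
  · rw [ind_eq_zero h.not_ge, ind_eq_one h, min_eq_right h.le]
    ring

theorem dualLamB_le_mul_channel (hPS : ∀ s, 0 ≤ PS s) (A : Auxiliary PYX T) (γ : ℝ) (x : X)
    (s : S) (y : Y) : dualLamB PS j A γ x s y ≤ PS s * PYX x y := by
  rw [dualLamB_eq_sum_min, A.channel_eq]
  exact mul_le_mul_of_nonneg_left (Finset.sum_le_sum fun t _ =>
    mul_le_mul_of_nonneg_right (min_le_left _ _) (A.isKernel_PVX.nonneg x t)) (hPS s)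

theorem dualLamB_le_mul_sum_Pbar (hPS : ∀ s, 0 ≤ PS s) (A : Auxiliary PYX T) (γ : ℝ) (x : X)
    (s : S) (y : Y) :
    dualLamB PS j A γ x s y ≤ PS s * Real.exp (j s - γ) * ∑ t, A.Pbar t y := by
  rw [dualLamB_eq_sum_min, mul_assoc]
  refine mul_le_mul_of_nonneg_left ?_ (hPS s)
  rw [Finset.mul_sum]
  refine Finset.sum_le_sum fun t _ => ?_
  calc
    min (A.PYXV x t y) (A.Pbar t y * Real.exp (j s - γ)) * A.PVX x t
      ≤ A.Pbar t y * Real.exp (j s - γ) * A.PVX x t :=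
        mul_le_mul_of_nonneg_right (min_le_right _ _) (A.isKernel_PVX.nonneg x t)
    _ ≤ A.Pbar t y * Real.exp (j s - γ) :=
        mul_le_of_le_one_right (mul_nonneg (A.isKernel_Pbar.nonneg t y) (Real.exp_pos _).le)
          (A.isKernel_PVX.le_one x t)
    _ = Real.exp (j s - γ) * A.Pbar t y := mul_comm _ _

variable [Fintype S]

theorem kvValue_le_improvedValue [Finite X] (hPS : ∀ s, 0 ≤ PS s) (A : Auxiliary PYX T) (γ : ℝ) :
    kvValue PS j A γ ≤ improvedValue PS j A γ :=
  sub_le_sub_right (Finset.sum_le_sum fun s _ => mul_le_mul_of_nonneg_left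
    (ciInf_mono (Set.finite_range _).bddBelow fun x =>
      le_add_of_nonneg_right (extraTerm_nonneg A (j s) γ x)) (hPS s)) _

theorem kvBound_le_improvedBound [Finite X] (hPS : ∀ s, 0 ≤ PS s) :
    kvBound PS PYX j ≤ improvedBound PS PYX j :=
  iSup_mono fun γ => iSup_le fun _ => iSup_mono fun _ => iSup_mono fun _ => iSup_mono fun A =>
    EReal.coe_le_coe_iff.2 (kvValue_le_improvedValue hPS A γ)

variable [Fintype X]

theorem dualPoint_feasible [Fintype Sh] (hPS : ∀ s, 0 ≤ PS s)
    (hj : ∀ sh, ∑ s, PS s * Real.exp (j s) * ind (d s sh ≤ ENNReal.ofReal dd) ≤ 1)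
    (A : Auxiliary PYX T) (γ : ℝ) :
    (dualPoint PS d dd j A γ).Feasible PS PYX (excessLoss d dd) where
  D1 x s := by
    simp only [dualPoint, Finset.sum_const_zero, sub_zero, sub_nonpos]
    exact ciInf_le (Set.finite_range _).bddBelow x
  D2 sh y := by
    simp only [dualPoint, Finset.sum_const_zero, sub_zero, Finset.sum_neg_distrib, sub_neg_eq_add]
    have hnonneg : 0 ≤ Real.exp (-γ) * ∑ t, A.Pbar t y := mul_nonneg (Real.exp_pos _).le
      (Finset.sum_nonneg fun t _ => A.isKernel_Pbar.nonneg t y)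
    have hfactor :
        ∑ s, PS s * Real.exp (j s - γ) * ind (d s sh ≤ ENNReal.ofReal dd) * ∑ t, A.Pbar t y =
          (∑ s, PS s * Real.exp (j s) * ind (d s sh ≤ ENNReal.ofReal dd)) *
            (Real.exp (-γ) * ∑ t, A.Pbar t y) := by
      rw [Finset.sum_mul]
      refine Finset.sum_congr rfl fun s _ => ?_
      rw [sub_eq_add_neg, Real.exp_add]
      ring
    rw [hfactor]
    linarith [mul_le_mul_of_nonneg_right (hj sh) hnonneg]
  D3 s x y sh := by
    simp only [dualPoint, excessLoss, add_zero]
    rcases le_or_gt (d s sh) (ENNReal.ofReal dd) with h | h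
    · rw [ind_eq_one h, ind_eq_zero h.not_gt]
      linarith [dualLamB_le_mul_sum_Pbar (j := j) hPS A γ x s y]
    · rw [ind_eq_zero h.not_ge, ind_eq_one h]
      linarith [dualLamB_le_mul_channel (j := j) hPS A γ x s y]
  mu_nonneg _ _ _ _ := le_rfl

theorem dualPoint_objective [Fintype Sh] (hPS : ∀ s, 0 ≤ PS s) (A : Auxiliary PYX T) (γ : ℝ) :
    (dualPoint PS d dd j A γ).objective = improvedValue PS j A γ := by
  simp only [DPPoint.objective, dualPoint, Finset.sum_const_zero, sub_zero, sum_dualLamB,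
    improvedValue, ← Finset.mul_sum]
  rw [Finset.sum_comm]
  simp only [A.isKernel_Pbar.sum_eq_one, Finset.sum_const, Finset.card_univ, Fintype.card_fin,
    nsmul_eq_mul, mul_one, Real.mul_iInf_of_nonneg (hPS _)]
  ring

theorem improvedBound_le_optDP [Fintype Sh] (hPS : ∀ s, 0 ≤ PS s)
    (hj : ∀ sh, ∑ s, PS s * Real.exp (j s) * ind (d s sh ≤ ENNReal.ofReal dd) ≤ 1) :
    improvedBound PS PYX j ≤ optDP PS PYX (excessLoss d dd) :=
  iSup_le fun γ => iSup_le fun _ => iSup_le fun _ => iSup_le fun A =>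
    le_iSup₂_of_le (dualPoint PS d dd j A γ) (dualPoint_feasible hPS hj A γ)
      (EReal.coe_le_coe_iff.2 (dualPoint_objective hPS A γ).ge)

end DualPoint

/-! ### Codes -/

section Codes

variable {S X Y Sh : Type*}

/-- The point of SC that corresponds to the randomized code with encoder `QXS` and decoder
`QShY`. -/
def SCPoint.ofCode (PS : S → ℝ) (PYX : X → Y → ℝ) (QXS : S → X → ℝ) (QShY : Y → Sh → ℝ) :
    SCPoint S X Y Sh where
  Q s x y sh := PS s * QXS s x * PYX x y * QShY y sh
  QXS := QXS
  QShY := QShY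

/-- The point of LP with `W = Q_{X|S} Q_{Ŝ|Y}`. -/
def SCPoint.toLPPoint (p : SCPoint S X Y Sh) : LPPoint S X Y Sh where
  QXS := p.QXS
  QShY := p.QShY
  W s x y sh := p.QXS s x * p.QShY y sh

variable [Fintype X] [Fintype Sh] {PS : S → ℝ} {PYX : X → Y → ℝ}

theorem SCPoint.feasible_ofCode {QXS : S → X → ℝ} {QShY : Y → Sh → ℝ} (hX : IsKernel QXS)
    (hSh : IsKernel QShY) : (SCPoint.ofCode PS PYX QXS QShY).Feasible PS PYX :=
  ⟨fun _ _ _ _ => rfl, hX, hSh⟩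

theorem SCPoint.Feasible.toLPPoint {p : SCPoint S X Y Sh} (hp : p.Feasible PS PYX) :
    p.toLPPoint.Feasible where
  sum_QXS := hp.2.1.sum_eq_one
  sum_QShY := hp.2.2.sum_eq_one
  sum_W_x s sh y := by
    simp only [SCPoint.toLPPoint, ← Finset.sum_mul, hp.2.1.sum_eq_one, one_mul, sub_self]
  sum_W_sh x s y := by
    simp only [SCPoint.toLPPoint, ← Finset.mul_sum, hp.2.2.sum_eq_one, mul_one, sub_self]
  mccormick s x y sh := by
    have h := mul_nonneg (sub_nonneg.2 (hp.2.1.le_one s x)) (sub_nonneg.2 (hp.2.2.le_one y sh))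
    simp only [SCPoint.toLPPoint]
    linarith
  QXS_nonneg := hp.2.1.nonneg
  QShY_nonneg := hp.2.2.nonneg
  W_nonneg s x y sh := mul_nonneg (hp.2.1.nonneg s x) (hp.2.2.nonneg y sh)

theorem LPPoint.exists_feasible [Nonempty X] [Nonempty Sh] :
    ∃ p : LPPoint S X Y Sh, p.Feasible := by
  classical
  exact ⟨_, (SCPoint.feasible_ofCode (PS := 0) (PYX := 0)
    (fun _ => single_mem_stdSimplex ℝ (Classical.arbitrary X))
    fun _ => single_mem_stdSimplex ℝ (Classical.arbitrary Sh)).toLPPoint⟩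

variable [Fintype S] [Fintype Y] {κ : S → X → Y → Sh → ℝ}

theorem SCPoint.Feasible.objective_toLPPoint {p : SCPoint S X Y Sh} (hp : p.Feasible PS PYX) :
    p.toLPPoint.objective PS PYX κ = p.objective κ := by
  simp only [LPPoint.objective, SCPoint.objective, SCPoint.toLPPoint, hp.1]
  exact Finset.sum_congr rfl fun s _ => Finset.sum_congr rfl fun x _ =>
    Finset.sum_congr rfl fun y _ => Finset.sum_congr rfl fun sh _ => by ring

theorem optLP_le_optSC : optLP PS PYX κ ≤ optSC PS PYX κ :=
  le_iInf₂ fun p hp => iInf₂_le_of_le p.toLPPoint hp.toLPPoint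
    (EReal.coe_le_coe_iff.2 hp.objective_toLPPoint.le)

theorem SCPoint.objective_ofCode_single [DecidableEq X] [DecidableEq Sh] (d : S → Sh → ℝ≥0∞)
    (dd : ℝ) (f : S → X) (g : Y → Sh) :
    (SCPoint.ofCode PS PYX (fun s => Pi.single (f s) 1) fun y => Pi.single (g y) 1).objective
      (excessLoss d dd) = excessProb PS PYX d dd f g := by
  simp only [SCPoint.objective, SCPoint.ofCode, excessProb, excessLoss, Pi.single_apply]
  refine Finset.sum_congr rfl fun s _ => ?_
  rw [Finset.sum_comm]
  refine Finset.sum_congr rfl fun y _ => ?_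
  simp [mul_comm]

theorem optSC_le_excessProb (d : S → Sh → ℝ≥0∞) (dd : ℝ) (f : S → X) (g : Y → Sh) :
    optSC PS PYX (excessLoss d dd) ≤ ((excessProb PS PYX d dd f g : ℝ) : EReal) := by
  classical
  rw [← SCPoint.objective_ofCode_single]
  exact iInf₂_le _ (SCPoint.feasible_ofCode (fun s => single_mem_stdSimplex ℝ (f s))
    fun y => single_mem_stdSimplex ℝ (g y))

end Codes

end JSCC

end

open JSCC in
theorem mainTheorem1_general
    {S X Y Sh : Type*} [Fintype S] [Fintype X] [Fintype Y] [Fintype Sh]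
    [Nonempty X] [Nonempty Sh]
    {PS : S → ℝ} (hPS : ∀ s, 0 ≤ PS s) (PYX : X → Y → ℝ)
    {d : S → Sh → ENNReal} {dd : ℝ} {j : S → ℝ}
    (hj : ∀ sh, ∑ s, PS s * Real.exp (j s) * ind (d s sh ≤ ENNReal.ofReal dd) ≤ 1) :
    (∀ (γ : ℝ) (T : ℕ), 0 < T → ∀ A : Auxiliary PYX T,
      (dualPoint PS d dd j A γ).Feasible PS PYX (excessLoss d dd) ∧
      (dualPoint PS d dd j A γ).objective = improvedValue PS j A γ ∧
      (∀ s x, 0 ≤ extraTerm A (j s) γ x) ∧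
      kvValue PS j A γ ≤ improvedValue PS j A γ) ∧
    (∀ (f : S → X) (g : Y → Sh),
      optSC PS PYX (excessLoss d dd) ≤ ((excessProb PS PYX d dd f g : ℝ) : EReal)) ∧
    (∀ p : SCPoint S X Y Sh, p.Feasible PS PYX →
      optSC PS PYX (excessLoss d dd) ≤ ((p.objective (excessLoss d dd) : ℝ) : EReal)) ∧
    optLP PS PYX (excessLoss d dd) ≤ optSC PS PYX (excessLoss d dd) ∧
    optLP PS PYX (excessLoss d dd) = optDP PS PYX (excessLoss d dd) ∧
    improvedBound PS PYX j ≤ optDP PS PYX (excessLoss d dd) ∧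
    kvBound PS PYX j ≤ improvedBound PS PYX j ∧
    (∃ p : DPPoint S X Y Sh, p.Feasible PS PYX (excessLoss d dd) ∧
      improvedBound PS PYX j ≤ ((p.objective : ℝ) : EReal)) := by
  have hLP : ∃ p : LPPoint S X Y Sh, p.Feasible := LPPoint.exists_feasible
  have hduality : optLP PS PYX (excessLoss d dd) = optDP PS PYX (excessLoss d dd) :=
    optLP_eq_optDP hLP
  have hbound : improvedBound PS PYX j ≤ optDP PS PYX (excessLoss d dd) :=
    improvedBound_le_optDP hPS hj
  obtain ⟨q, hq, hopt⟩ := exists_dual_optimum (PS := PS) (PYX := PYX) (κ := excessLoss d dd) hLP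
  exact ⟨fun γ _ _ A => ⟨dualPoint_feasible hPS hj A γ, dualPoint_objective hPS A γ,
      fun s x => extraTerm_nonneg A (j s) γ x, kvValue_le_improvedValue hPS A γ⟩,
    optSC_le_excessProb d dd, fun p hp => iInf₂_le p hp, optLP_le_optSC, hduality, hbound,
    kvBound_le_improvedBound hPS, q, hq, hbound.trans (hduality.ge.trans hopt)⟩

theorem mainTheorem1
    {S X Y Sh : Type*} [Fintype S] [Fintype X] [Fintype Y] [Fintype Sh]
    [Nonempty X] [Nonempty Sh]
    (PS : S → ℝ) (hPS : PS ∈ stdSimplex ℝ S)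
    (PYX : X → Y → ℝ) (hPYX : JSCC.IsKernel PYX)
    (d : S → Sh → ENNReal) (dd : ℝ) (hdd : 0 ≤ dd)
    (Wstar : S → Sh → ℝ) (hT : JSCC.TiltedSetting PS d dd Wstar)
    (κ : S → X → Y → Sh → ℝ) (hκ : κ = JSCC.excessLoss d dd)
    (j : S → ℝ) (hj : j = JSCC.tiltedInfo PS d dd Wstar) :
    -- for all parameters, the explicit point is feasible for DP, its objective is the improved
    -- expression, and the latter exceeds the Kostina-Verdú expression by a nonnegative term
    (∀ (γ : ℝ) (T : ℕ), 0 < T → ∀ A : JSCC.Auxiliary PYX T,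
      (JSCC.dualPoint PS d dd j A γ).Feasible PS PYX κ ∧
      (JSCC.dualPoint PS d dd j A γ).objective = JSCC.improvedValue PS j A γ ∧
      (∀ s x, 0 ≤ JSCC.extraTerm A (j s) γ x) ∧
      JSCC.kvValue PS j A γ ≤ JSCC.improvedValue PS j A γ) ∧
    -- the chain of lower bounds on the excess distortion probability of any code
    (∀ (f : S → X) (g : Y → Sh),
      JSCC.optSC PS PYX κ ≤ ((JSCC.excessProb PS PYX d dd f g : ℝ) : EReal)) ∧
    (∀ p : JSCC.SCPoint S X Y Sh, p.Feasible PS PYX →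
      JSCC.optSC PS PYX κ ≤ ((p.objective κ : ℝ) : EReal)) ∧
    JSCC.optLP PS PYX κ ≤ JSCC.optSC PS PYX κ ∧
    JSCC.optLP PS PYX κ = JSCC.optDP PS PYX κ ∧
    JSCC.improvedBound PS PYX j ≤ JSCC.optDP PS PYX κ ∧
    JSCC.kvBound PS PYX j ≤ JSCC.improvedBound PS PYX j ∧
    -- a single feasible point of DP is at least as good as both converses
    (∃ p : JSCC.DPPoint S X Y Sh, p.Feasible PS PYX κ ∧
      JSCC.improvedBound PS PYX j ≤ ((p.objective : ℝ) : EReal)) := by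
  subst hκ hj
  exact mainTheorem1_general hPS.1 PYX (hT.sum_exp_tiltedInfo_le_one hPS)
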